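/- Theorem (Linearized stability theorem). Let $d\in\mathbb N$, let $\|\cdot\|$ be any norm on $\mathbb R^d$, let $\alpha\in(0,1)$, $\tau>0$, $A\in\mathbb R^{d\times d}$ and $g:\mathbb R^d\times\mathbb R^d\to\mathbb R^d$. Consider the delay Caputo fractional initial value problem $$ {}^{C}\!D^{\alpha}_{0+}x(t)=A\,x(t-\tau)+g\bigl(x(t),x(t-\tau)\bigr)\quad (t>0),\qquad x(t)=\phi(t)\quad (t\in[-\tau,0]), \tag{1}$$ with $\phi\in C([-\tau,0];\mathbb R^d)$. Here the Caputo derivative is taken componentwise and, for a continuous real function $x$, it is ${}^{C}\!D^{\alpha}_{0+}x(t)=\frac{d}{dt}\,\frac{1}{\Gamma(1-\alpha)}\int_0^t (t-s)^{-\alpha}\bigl(x(s)-x(0)\bigr)\,ds$. For $T>0$, a solution of (1) over $[-\tau,T]$ is a continuous function $x:[-\tau,T]\to\mathbb R^d$ with $x=\phi$ on $[-\tau,0]$ whose Caputo derivative exists and satisfies the equation at every $t\in(0,T]$ (the derivative $\frac{d}{dt}$ at $t=T$ being the left one). Assume that 1. $g(0,0)=0$; 2. $g$ is locally Lipschitz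 continuous in a neighbourhood of the origin and $\lim_{\varrho\to0^+}\ell_g(\varrho)=0$, where $$\ell_g(\varrho)=\sup\left\{\frac{\|g(x,y)-g(\hat x,\hat y)\|}{\|x-\hat x\|+\|y-\hat y\|}\;:\;\|x\|,\|y\|,\|\hat x\|,\|\hat y\|\le\varrho,\ (x,y)\ne(\hat x,\hat y)\right\};$$ 3. every eigenvalue of $A$ in $\mathbb C$ lies in $$\mathcal S_{\alpha,\tau}=\left\{\lambda\in\mathbb C\setminus\{0\}:\ |\lambda|<\left(\frac{|\arg\lambda|-\alpha\pi/2}{\tau}\right)^{\alpha},\ \frac{\alpha\pi}{2}<|\arg\lambda|\le\pi\right\}.$$ Then the trivial solution of (1) is asymptotically stable, that is: (i) for every $\varepsilon>0$ there is $\delta>0$ such that for every $\phi\in C([-\tau,0];\mathbb R^d)$ with $\sup_{[-\tau,0]}\|\phi\|\le\delta$ the problem (1) has a solution $\varphi(\cdot,\phi)$ on $[-\tau,\infty)$, it is unique (every solution over some $[-\tau,T]$ is a restriction of it), and $\|\varphi(t,\phi)\|\le\varepsilon$ for all $t\ge0$; (ii) there is $\hat\delta>0$ such that for every $\phi\in C([-\tau,0];\mathbb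 R^d)$ with $\sup_{[-\tau,0]}\|\phi\|\le\hat\delta$ the problem (1) has a unique solution $\varphi(\cdot,\phi)$ on $[-\tau,\infty)$ in the same sense, and $\lim_{t\to\infty}\varphi(t,\phi)=0$. -/

import Mathlib

open Set Filter Topology
open scoped ENNReal

namespace DelayFDE

/-- The Riemann--Liouville integral of order `β` based at `0` of a real function:
`(1 / Γ(β)) ∫₀ᵗ (t - s)^(β - 1) x(s) ds`. -/
noncomputable def rlIntegral (β : ℝ) (x : ℝ → ℝ) (t : ℝ) : ℝ :=
  (1 / Real.Gamma β) * ∫ s in (0 : ℝ)..t, (t - s) ^ (β - 1) * x s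

/-- For `0 < α < 1`, `t ∈ (0, T]` and `x` continuous on `[0, T]`: the function `x` has Caputo
derivative `y` of order `α`, based at `0`, at the point `t` of the interval `[0, T]`. The Caputo
derivative of a continuous function is `d/dt I^{1-α} (x - x(0))`, the derivative at the end point
`T` being the left one. On absolutely continuous `x` this is `I^{1-α} x'`. -/
def HasCaputoDerivWithin (α T : ℝ) (x : ℝ → ℝ) (y t : ℝ) : Prop :=
  HasDerivWithinAt (rlIntegral (1 - α) (fun s => x s - x 0)) y (Icc 0 T) t

/-- `x` is a solution over `[-τ, T]` of the initial value problem
`ᶜD^α x(t) = A x(t - τ) + g(x(t), x(t - τ))` on `(0, T]`, `x = φ` on `[-τ, 0]`,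
the Caputo derivative being taken componentwise. -/
structure IsSolutionOn {d : ℕ} (α τ : ℝ) (A : Matrix (Fin d) (Fin d) ℝ)
    (g : (Fin d → ℝ) → (Fin d → ℝ) → (Fin d → ℝ)) (φ : ℝ → Fin d → ℝ) (T : ℝ)
    (x : ℝ → Fin d → ℝ) : Prop where
  continuousOn : ContinuousOn x (Icc (-τ) T)
  equation : ∀ t ∈ Ioc 0 T, ∀ i : Fin d,
    HasCaputoDerivWithin α T (fun s => x s i)
      ((A.mulVec (x (t - τ)) + g (x t) (x (t - τ))) i) t
  initial : ∀ t ∈ Icc (-τ) 0, x t = φ t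

/-- `x` is the solution with initial function `φ` and its maximal interval of existence is
`[-τ, ∞)`: it is a solution over every `[-τ, T]`, and every solution over some `[-τ, T]` is a
restriction of it. -/
def IsTheGlobalSolution {d : ℕ} (α τ : ℝ) (A : Matrix (Fin d) (Fin d) ℝ)
    (g : (Fin d → ℝ) → (Fin d → ℝ) → (Fin d → ℝ)) (φ : ℝ → Fin d → ℝ)
    (x : ℝ → Fin d → ℝ) : Prop :=
  (∀ T : ℝ, 0 < T → IsSolutionOn α τ A g φ T x) ∧
    ∀ T : ℝ, 0 < T → ∀ y : ℝ → Fin d → ℝ, IsSolutionOn α τ A g φ T y →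
      EqOn y x (Icc (-τ) T)

/-- Stability of the trivial solution, with respect to the norm `p` on `ℝ^d`. -/
def IsStable {d : ℕ} (p : Seminorm ℝ (Fin d → ℝ)) (α τ : ℝ) (A : Matrix (Fin d) (Fin d) ℝ)
    (g : (Fin d → ℝ) → (Fin d → ℝ) → (Fin d → ℝ)) : Prop :=
  ∀ ε : ℝ, 0 < ε → ∃ δ : ℝ, 0 < δ ∧
    ∀ φ : ℝ → Fin d → ℝ, ContinuousOn φ (Icc (-τ) 0) → (∀ s ∈ Icc (-τ) 0, p (φ s) ≤ δ) →
      ∃ x : ℝ → Fin d → ℝ, IsTheGlobalSolution α τ A g φ x ∧ ∀ t : ℝ, 0 ≤ t → p (x t) ≤ ε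

/-- Asymptotic stability of the trivial solution, with respect to the norm `p` on `ℝ^d`. -/
def IsAsymptoticallyStable {d : ℕ} (p : Seminorm ℝ (Fin d → ℝ)) (α τ : ℝ)
    (A : Matrix (Fin d) (Fin d) ℝ)
    (g : (Fin d → ℝ) → (Fin d → ℝ) → (Fin d → ℝ)) : Prop :=
  IsStable p α τ A g ∧ ∃ δ : ℝ, 0 < δ ∧
    ∀ φ : ℝ → Fin d → ℝ, ContinuousOn φ (Icc (-τ) 0) → (∀ s ∈ Icc (-τ) 0, p (φ s) ≤ δ) →
      ∃ x : ℝ → Fin d → ℝ, IsTheGlobalSolution α τ A g φ x ∧ Tendsto x atTop (𝓝 0)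

/-- The domain `S_{α,τ}` of the complex plane. -/
def stabilityRegion (α τ : ℝ) : Set ℂ :=
  {z : ℂ | z ≠ 0 ∧ ‖z‖ < ((|z.arg| - α * Real.pi / 2) / τ) ^ α ∧
    α * Real.pi / 2 < |z.arg| ∧ |z.arg| ≤ Real.pi}

/-- The Lipschitz modulus `ℓ_g(ρ)` of `g` on the ball of radius `ρ` for the norm `p`, as an
extended nonnegative number. -/
noncomputable def lipModulus {d : ℕ} (p : Seminorm ℝ (Fin d → ℝ))
    (g : (Fin d → ℝ) → (Fin d → ℝ) → (Fin d → ℝ)) (ρ : ℝ) : ℝ≥0∞ :=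
  ⨆ (x : Fin d → ℝ) (y : Fin d → ℝ) (x' : Fin d → ℝ) (y' : Fin d → ℝ)
    (_ : (p x ≤ ρ ∧ p y ≤ ρ ∧ p x' ≤ ρ ∧ p y' ≤ ρ) ∧ (x, y) ≠ (x', y')),
    ENNReal.ofReal (p (g x y - g x' y') / (p (x - x') + p (y - y')))

end DelayFDE

/-!
Formally, the linear equation `ᶜD^α x = A x(· - τ) + f` has Laplace transform
`s ^ α X = A exp (-s τ) X + F`. Dividing by `(1 + s) ^ α` instead of by `s ^ α` turns it into
`(1 - Q (N + A S)) x = Q f`, in which `Q` and `N` are the convolutions with the integrable kernels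
of Laplace transforms `(1 + s) ^ (-α)` and `(1 + s) ^ α - s ^ α`, and `S` is the shift by `τ`.
All of these act on continuous functions tending to zero and generate a commutative Banach algebra,
whose characters either kill `Q` or come from a point `s` with `0 ≤ re s`. Hence
`1 - Q (N + A S)` is invertible as soon as `s ^ α - λ exp (-s τ)` has no zero with `0 ≤ re s`, for
every eigenvalue `λ` of `A`, and this is what the stability region says. The inverse is a solution
operator of the linear equation on functions tending to zero, and for small initial functions the
nonlinear equation becomes a fixed point equation for a contraction there. Solutions are unique
because the fractional integral is a contraction for exponentially weighted norms.
-/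

namespace DelayFDE

open MeasureTheory ContinuousLinearMap
open scoped Convolution

/-! ### Convolution of causal functions -/

section Causal

variable {E : Type*} [NormedAddCommGroup E]

/-- A function on the line is causal if it vanishes on the negative half-line; the value at `0` is
not restricted, so that a causal function may jump there. -/
def Causal (w : ℝ → E) : Prop := ∀ t < 0, w t = 0

/-- Causal functions which are integrable on every `(-∞, T]`: the convolution kernels. -/
structure CausalIntegrable (a : ℝ → E) : Prop where
  causal : Causal a
  integrableOn_Iic : ∀ T, IntegrableOn a (Iic T)

/-- Causal functions which are continuous on `[0, ∞)`: the functions kernels act on. -/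
structure CausalContinuous (w : ℝ → E) : Prop where
  causal : Causal w
  continuousOn_Ici : ContinuousOn w (Ici 0)

theorem Causal.indicator {w : ℝ → E} (hw : Causal w) (s : Set ℝ) : Causal (s.indicator w) :=
  fun t ht => by classical rw [indicator_apply, hw t ht, ite_self]

theorem Causal.norm {w : ℝ → E} (hw : Causal w) : Causal fun t => ‖w t‖ :=
  fun t ht => norm_eq_zero.2 (hw t ht)

namespace CausalIntegrable

variable {a : ℝ → E}

theorem integrable_indicator_Iic (ha : CausalIntegrable a) (T : ℝ) :
    Integrable ((Iic T).indicator a) :=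
  (integrable_indicator_iff measurableSet_Iic).2 (ha.integrableOn_Iic T)

theorem aestronglyMeasurable (ha : CausalIntegrable a) : AEStronglyMeasurable a :=
  (locallyIntegrable_iff.2 fun _ hK =>
    let ⟨T, hT⟩ := hK.bddAbove
    (ha.integrableOn_Iic T).mono_set hT).aestronglyMeasurable

theorem indicator (ha : CausalIntegrable a) {s : Set ℝ} (hs : MeasurableSet s) :
    CausalIntegrable (s.indicator a) :=
  ⟨ha.causal.indicator s, fun T => (ha.integrableOn_Iic T).indicator hs⟩

theorem of_integrable (h : Integrable a) (h0 : Causal a) : CausalIntegrable a :=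
  ⟨h0, fun _ => h.integrableOn⟩

theorem of_integrableOn_Ioc (h0 : Causal a) (h : ∀ T, 0 < T → IntegrableOn a (Ioc 0 T)) :
    CausalIntegrable a where
  causal := h0
  integrableOn_Iic T := by
    have h_neg : IntegrableOn a (Iic 0) := by
      rw [integrableOn_Iic_iff_integrableOn_Iio]
      exact integrableOn_zero.congr_fun (fun t ht => (h0 t ht).symm) measurableSet_Iio
    refine (h_neg.union (h (max T 1) (by positivity))).mono_set ?_
    rw [Iic_union_Ioc_eq_Iic (by positivity)]
    exact Iic_subset_Iic.2 (le_max_left _ _)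

end CausalIntegrable

namespace CausalContinuous

variable {v w : ℝ → E}

theorem of_continuous (h : Continuous w) (h0 : Causal w) : CausalContinuous w :=
  ⟨h0, h.continuousOn⟩

theorem indicator_Ici (h : Continuous w) : CausalContinuous ((Ici 0).indicator w) :=
  ⟨fun _ ht => indicator_of_notMem (by simpa using ht) _,
    h.continuousOn.congr fun _ ht => indicator_of_mem ht _⟩

theorem exists_norm_le (hw : CausalContinuous w) (T : ℝ) : ∃ C, 0 ≤ C ∧ ∀ t ≤ T, ‖w t‖ ≤ C := by
  obtain ⟨C, hC⟩ := (isCompact_Icc (a := (0 : ℝ)) (b := T)).exists_bound_of_continuousOn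
    (hw.continuousOn_Ici.mono Icc_subset_Ici_self)
  refine ⟨max C 0, le_max_right _ _, fun t ht => ?_⟩
  rcases lt_or_ge t 0 with h | h
  · simp [hw.causal t h]
  · exact (hC t ⟨h, ht⟩).trans (le_max_left _ _)

theorem exists_norm_le_of_tendsto (hw : CausalContinuous w) (hlim : Tendsto w atTop (𝓝 0)) :
    ∃ C, ∀ t, ‖w t‖ ≤ C := by
  obtain ⟨T, hT⟩ := eventually_atTop.1 (hlim.norm.eventually_le_const (by simp : ‖(0 : E)‖ < 1))
  obtain ⟨C, -, hC⟩ := hw.exists_norm_le T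
  exact ⟨max C 1, fun t => (le_total t T).elim (fun h => (hC t h).trans (le_max_left _ _))
    fun h => (hT t h).trans (le_max_right _ _)⟩

theorem causalIntegrable (hw : CausalContinuous w) : CausalIntegrable w :=
  .of_integrableOn_Ioc hw.causal fun _ _ =>
    (hw.continuousOn_Ici.mono Icc_subset_Ici_self).integrableOn_Icc.mono_set Ioc_subset_Icc_self

theorem continuousAt (hw : CausalContinuous w) {t : ℝ} (ht : t ≠ 0) : ContinuousAt w t := by
  rcases lt_or_gt_of_ne ht with h | h
  · refine continuousAt_const.congr (f := fun _ => (0 : E)) ?_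
    filter_upwards [Iio_mem_nhds h] with s hs using (hw.causal s hs).symm
  · exact hw.continuousOn_Ici.continuousAt (Ici_mem_nhds h)

theorem norm (hw : CausalContinuous w) : CausalContinuous fun t => ‖w t‖ :=
  ⟨hw.causal.norm, hw.continuousOn_Ici.norm⟩

theorem clm_comp {F : Type*} [NormedAddCommGroup F] [NormedSpace ℝ E] [NormedSpace ℝ F]
    (L : E →L[ℝ] F) (hw : CausalContinuous w) : CausalContinuous (L ∘ w) :=
  ⟨fun t ht => by simp [hw.causal t ht], L.continuous.comp_continuousOn hw.continuousOn_Ici⟩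

theorem add (hv : CausalContinuous v) (hw : CausalContinuous w) : CausalContinuous (v + w) :=
  ⟨fun t ht => by simp [hv.causal t ht, hw.causal t ht],
    hv.continuousOn_Ici.add hw.continuousOn_Ici⟩

theorem sub (hv : CausalContinuous v) (hw : CausalContinuous w) : CausalContinuous (v - w) :=
  ⟨fun t ht => by simp [hv.causal t ht, hw.causal t ht],
    hv.continuousOn_Ici.sub hw.continuousOn_Ici⟩

end CausalContinuous

end Causal

section Convolution

variable {E : Type*} [NormedAddCommGroup E] [NormedSpace ℝ E] {a a' b : ℝ → ℝ} {v w w' : ℝ → E}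

theorem convolution_mul_comm (a b : ℝ → ℝ) : a ⋆ b = b ⋆ a := by
  funext t
  rw [convolution_lsmul_swap]
  simp only [convolution, lsmul_apply, smul_eq_mul, mul_comm]

theorem Causal.convolution (ha : Causal a) (hw : Causal w) : Causal (a ⋆ w) := fun t ht =>
  integral_eq_zero_of_ae <| Eventually.of_forall fun u => by
    rcases lt_or_ge u 0 with hu | hu
    · simp [ha u hu]
    · simp [hw (t - u) (by linarith)]

theorem Causal.smul_comp_sub_congr {t : ℝ} (ha : Causal a) (ha' : Causal a') (hw : Causal w)
    (hw' : Causal w') (haa' : EqOn a a' (Iic t)) (hww' : EqOn w w' (Iic t)) (u : ℝ) :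
    a u • w (t - u) = a' u • w' (t - u) := by
  rcases lt_or_ge u 0 with hu | hu
  · rw [ha u hu, ha' u hu, zero_smul, zero_smul]
  · rcases lt_or_ge (t - u) 0 with h | h
    · rw [hw _ h, hw' _ h, smul_zero, smul_zero]
    · rw [haa' (mem_Iic.2 (by linarith)), hww' (mem_Iic.2 (by linarith))]

theorem Causal.convolution_congr {t : ℝ} (ha : Causal a) (ha' : Causal a') (hw : Causal w)
    (hw' : Causal w') (haa' : EqOn a a' (Iic t)) (hww' : EqOn w w' (Iic t)) :
    (a ⋆ w) t = (a' ⋆ w') t :=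
  integral_congr_ae (Eventually.of_forall (ha.smul_comp_sub_congr ha' hw hw' haa' hww'))

theorem Causal.convolution_eq_intervalIntegral {t : ℝ} (ha : Causal a) (hw : Causal w)
    (ht : 0 ≤ t) : (a ⋆ w) t = ∫ s in (0 : ℝ)..t, a (t - s) • w s := by
  rw [convolution_lsmul_swap, intervalIntegral.integral_of_le ht, ← integral_Icc_eq_integral_Ioc,
    setIntegral_eq_integral_of_forall_compl_eq_zero]
  intro s hs
  rcases lt_or_ge s 0 with h | h
  · rw [hw s h, smul_zero]
  · rw [ha (t - s) (by by_contra h'; exact hs ⟨h, by linarith⟩), zero_smul]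

theorem Causal.convolution_of_nonpos {t : ℝ} (ha : Causal a) (hw : Causal w) (ht : t ≤ 0) :
    (a ⋆ w) t = 0 := by
  rcases ht.lt_or_eq with h | rfl
  · exact ha.convolution hw t h
  · rw [ha.convolution_eq_intervalIntegral hw le_rfl, intervalIntegral.integral_same]

theorem convolution_comp_sub_right (a : ℝ → ℝ) (w : ℝ → E) (τ t : ℝ) :
    (a ⋆ fun s => w (s - τ)) t = (a ⋆ w) (t - τ) := by
  simp only [convolution, sub_right_comm]

theorem convolution_const_smul {R : Type*} [NormedField R] [NormedSpace R E] [SMulCommClass ℝ R E]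
    (a : ℝ → ℝ) (c : R) (w : ℝ → E) : a ⋆ (c • w) = c • (a ⋆ w) := by
  funext t
  simp only [convolution, lsmul_apply, Pi.smul_apply, smul_comm _ c]
  exact integral_smul c _

theorem norm_convolution_le {C : ℝ} (ha : Integrable a) (hC : ∀ t, ‖w t‖ ≤ C) (t : ℝ) :
    ‖(a ⋆ w) t‖ ≤ (∫ u, ‖a u‖) * C := by
  rw [← integral_mul_const]
  refine norm_integral_le_of_norm_le (ha.norm.mul_const C) (Eventually.of_forall fun u => ?_)
  rw [lsmul_apply, norm_smul]
  gcongr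
  exact hC _

theorem Causal.norm_smul_comp_sub_le {C T t : ℝ} (ha : Causal a) (hw : Causal w) (hC0 : 0 ≤ C)
    (hC : ∀ s ≤ T, ‖w s‖ ≤ C) (ht : t ≤ T) (u : ℝ) :
    ‖a u • w (t - u)‖ ≤ ‖(Iic T).indicator a u‖ * C := by
  rw [norm_smul]
  rcases lt_or_ge u 0 with hu | hu
  · rw [ha u hu, norm_zero, zero_mul]
    positivity
  · by_cases h : u ≤ T
    · rw [indicator_of_mem (mem_Iic.2 h)]
      gcongr
      exact hC _ (by linarith)
    · rw [hw (t - u) (by linarith), norm_zero, mul_zero]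
      positivity

theorem CausalIntegrable.convolutionExists (ha : CausalIntegrable a) (hw : CausalContinuous w) :
    ConvolutionExists a w (lsmul ℝ ℝ) volume := fun t => by
  obtain ⟨C, hC0, hC⟩ := hw.exists_norm_le t
  exact ((ha.integrable_indicator_Iic t).norm.mul_const C).mono'
    (ha.aestronglyMeasurable.convolution_integrand_snd _ hw.causalIntegrable.aestronglyMeasurable t)
    (Eventually.of_forall (ha.causal.norm_smul_comp_sub_le hw.causal hC0 hC le_rfl))

theorem CausalIntegrable.continuous_convolution (ha : CausalIntegrable a)
    (hw : CausalContinuous w) : Continuous (a ⋆ w) := by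
  refine continuous_iff_continuousAt.2 fun t₀ => ?_
  obtain ⟨C, hC0, hC⟩ := hw.exists_norm_le (t₀ + 1)
  refine continuousAt_of_dominated (bound := fun u => ‖(Iic (t₀ + 1)).indicator a u‖ * C)
    (Eventually.of_forall fun t => (ha.convolutionExists hw t).aestronglyMeasurable) ?_
    ((ha.integrable_indicator_Iic _).norm.mul_const C) ?_
  · filter_upwards [Iio_mem_nhds (lt_add_one t₀)] with t ht
    exact Eventually.of_forall (ha.causal.norm_smul_comp_sub_le hw.causal hC0 hC (mem_Iio.1 ht).le)
  · filter_upwards [Measure.ae_ne volume t₀] with u hu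
    exact continuousAt_const.smul <| ContinuousAt.comp (f := fun t => t - u)
      (hw.continuousAt (sub_ne_zero.2 hu.symm)) (by fun_prop)

theorem CausalContinuous.convolution (ha : CausalIntegrable a) (hw : CausalContinuous w) :
    CausalContinuous (a ⋆ w) :=
  .of_continuous (ha.continuous_convolution hw) (ha.causal.convolution hw.causal)

theorem CausalIntegrable.convolution_sub (ha : CausalIntegrable a) (hv : CausalContinuous v)
    (hw : CausalContinuous w) : a ⋆ (v - w) = a ⋆ v - a ⋆ w := by
  funext t
  simp only [MeasureTheory.convolution, map_sub, Pi.sub_apply]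
  exact integral_sub (ha.convolutionExists hv t) (ha.convolutionExists hw t)

theorem CausalIntegrable.convolution_clm_comp {F : Type*} [NormedAddCommGroup F]
    [NormedSpace ℝ F] [CompleteSpace E] [CompleteSpace F] (L : E →L[ℝ] F)
    (ha : CausalIntegrable a) (hw : CausalContinuous w) : a ⋆ (L ∘ w) = L ∘ (a ⋆ w) := by
  funext t
  simp only [MeasureTheory.convolution, lsmul_apply, Function.comp_apply, ← map_smul]
  exact L.integral_comp_comm (ha.convolutionExists hw t)

theorem CausalIntegrable.convolution (ha : CausalIntegrable a) (hb : CausalIntegrable b) :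
    CausalIntegrable (a ⋆ b) where
  causal := ha.causal.convolution hb.causal
  integrableOn_Iic T :=
    ((ha.integrable_indicator_Iic T).integrable_convolution (lsmul ℝ ℝ)
      (hb.integrable_indicator_Iic T)).integrableOn.congr_fun
      (fun _ ht => (ha.causal.indicator _).convolution_congr ha.causal (hb.causal.indicator _)
        hb.causal (eqOn_indicator.mono (Iic_subset_Iic.2 ht))
        (eqOn_indicator.mono (Iic_subset_Iic.2 ht))) measurableSet_Iic

theorem CausalIntegrable.ae_convolutionExistsAt (ha : CausalIntegrable a)
    (hb : CausalIntegrable b) : ∀ᵐ t, ConvolutionExistsAt a b t (lsmul ℝ ℝ) volume := by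
  have truncated : ∀ n : ℕ, ∀ᵐ t, ConvolutionExistsAt ((Iic (n : ℝ)).indicator a)
      ((Iic (n : ℝ)).indicator b) t (lsmul ℝ ℝ) volume := fun n =>
    (ha.integrable_indicator_Iic n).ae_convolution_exists _ (hb.integrable_indicator_Iic n)
  filter_upwards [ae_all_iff.2 truncated] with t ht
  obtain ⟨n, hn⟩ := exists_nat_ge t
  exact (ht n).congr (Eventually.of_forall <| (ha.causal.indicator _).smul_comp_sub_congr ha.causal
    (hb.causal.indicator _) hb.causal (eqOn_indicator.mono (Iic_subset_Iic.2 hn))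
    (eqOn_indicator.mono (Iic_subset_Iic.2 hn)))

theorem CausalIntegrable.norm (ha : CausalIntegrable a) : CausalIntegrable fun t => ‖a t‖ :=
  ⟨ha.causal.norm, fun T => (ha.integrableOn_Iic T).norm⟩

theorem CausalIntegrable.convolution_assoc [CompleteSpace E] (ha : CausalIntegrable a)
    (hb : CausalIntegrable b) (hw : CausalContinuous w) : (a ⋆ b) ⋆ w = a ⋆ (b ⋆ w) := by
  funext t
  exact MeasureTheory.convolution_assoc (lsmul ℝ ℝ) (lsmul ℝ ℝ) (lsmul ℝ ℝ) (lsmul ℝ ℝ)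
    (fun x y z => by simp only [lsmul_apply, smul_eq_mul, mul_smul])
    ha.aestronglyMeasurable hb.aestronglyMeasurable hw.causalIntegrable.aestronglyMeasurable
    (ha.ae_convolutionExistsAt hb) (Eventually.of_forall (hb.norm.convolutionExists hw.norm))
    (ha.norm.convolutionExists (.convolution hb.norm hw.norm) t)

theorem CausalIntegrable.convolution_left_comm [CompleteSpace E] (ha : CausalIntegrable a)
    (hb : CausalIntegrable b) (hw : CausalContinuous w) : a ⋆ (b ⋆ w) = b ⋆ (a ⋆ w) := by
  rw [← ha.convolution_assoc hb hw, convolution_mul_comm a b, hb.convolution_assoc ha hw]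

theorem tendsto_convolution_atTop {C : ℝ} (ha : Integrable a) (hw : AEStronglyMeasurable w)
    (hC : ∀ t, ‖w t‖ ≤ C) (hlim : Tendsto w atTop (𝓝 0)) : Tendsto (a ⋆ w) atTop (𝓝 0) := by
  rw [← integral_zero ℝ E (μ := volume)]
  refine tendsto_integral_filter_of_dominated_convergence (fun u => ‖a u‖ * C)
    (Eventually.of_forall fun t => ha.aestronglyMeasurable.convolution_integrand_snd _ hw t)
    (Eventually.of_forall fun t => Eventually.of_forall fun u => ?_)
    (ha.norm.mul_const C) (Eventually.of_forall fun u => ?_)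
  · rw [lsmul_apply, norm_smul]
    gcongr
    exact hC _
  · simpa [Function.comp_def, sub_eq_add_neg] using
      (hlim.comp (tendsto_atTop_add_const_right atTop (-u) tendsto_id)).const_smul (a u)

/-- The indicator of `[0, ∞)`, convolution with which is integration from `0`. -/
noncomputable abbrev heaviside : ℝ → ℝ := (Ici 0).indicator 1

theorem causalContinuous_heaviside : CausalContinuous heaviside := .indicator_Ici continuous_const

theorem heaviside_convolution {t : ℝ} (hw : Causal w) (ht : 0 ≤ t) :
    (heaviside ⋆ w) t = ∫ s in (0 : ℝ)..t, w s := by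
  rw [causalContinuous_heaviside.causal.convolution_eq_intervalIntegral hw ht]
  refine intervalIntegral.integral_congr fun s hs => ?_
  rw [uIcc_of_le ht] at hs
  simp [hs.2]

end Convolution

/-! ### The Riemann–Liouville kernels and their tempered versions -/

section Kernels

variable {α β t : ℝ}

/-- The kernel `t ^ (β - 1) / Γ(β)` on `(0, ∞)`, convolution with which is the Riemann–Liouville
integral of order `β`; its Laplace transform is `s ^ (-β)`. It is `0` at the origin, also when
`β = 1`. -/
noncomputable def rlKernel (β : ℝ) : ℝ → ℝ :=
  (Ioi 0).indicator fun t => t ^ (β - 1) / Real.Gamma β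

/-- The integrable kernel `exp (-t) t ^ (β - 1) / Γ(β)`, with Laplace transform
`(1 + s) ^ (-β)`. -/
noncomputable def temperedKernel (β t : ℝ) : ℝ := Real.exp (-t) * rlKernel β t

/-- The integrable kernel with Laplace transform `(1 + s) ^ α - s ^ α`: the difference between the
tempered and the original fractional derivative of order `α` is convolution with it. -/
noncomputable def correctionKernel (α t : ℝ) : ℝ :=
  α * rlKernel (1 - α) t * ((1 - Real.exp (-t)) / t)

theorem rlKernel_of_pos (ht : 0 < t) : rlKernel β t = t ^ (β - 1) / Real.Gamma β :=
  indicator_of_mem (mem_Ioi.2 ht) _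

theorem rlKernel_of_nonpos (ht : t ≤ 0) : rlKernel β t = 0 :=
  indicator_of_notMem (by simpa using ht) _

theorem temperedKernel_of_nonpos (ht : t ≤ 0) : temperedKernel β t = 0 := by
  rw [temperedKernel, rlKernel_of_nonpos ht, mul_zero]

theorem correctionKernel_of_nonpos (ht : t ≤ 0) : correctionKernel α t = 0 := by
  rw [correctionKernel, rlKernel_of_nonpos ht, mul_zero, zero_mul]

theorem causal_rlKernel (β : ℝ) : Causal (rlKernel β) := fun _ ht => rlKernel_of_nonpos ht.le

theorem causal_temperedKernel (β : ℝ) : Causal (temperedKernel β) :=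
  fun _ ht => temperedKernel_of_nonpos ht.le

theorem causal_correctionKernel (α : ℝ) : Causal (correctionKernel α) :=
  fun _ ht => correctionKernel_of_nonpos ht.le

theorem rlKernel_nonneg (hβ : 0 < β) (t : ℝ) : 0 ≤ rlKernel β t := by
  have := Real.Gamma_pos_of_pos hβ
  exact indicator_nonneg (fun s hs => by have : 0 < s := hs; positivity) t

theorem measurable_rlKernel (β : ℝ) : Measurable (rlKernel β) :=
  Measurable.indicator (by fun_prop) measurableSet_Ioi

theorem hasDerivAt_rlKernel (β : ℝ) (ht : 0 < t) :
    HasDerivAt (rlKernel β) ((β - 1) * rlKernel β t / t) t := by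
  have h := (Real.hasDerivAt_rpow_const (p := β - 1) (Or.inl ht.ne')).div_const (Real.Gamma β)
  rw [Real.rpow_sub_one ht.ne'] at h
  rw [rlKernel_of_pos ht]
  refine (h.congr_of_eventuallyEq ?_).congr_deriv (by ring)
  filter_upwards [Ioi_mem_nhds ht] with s hs using rlKernel_of_pos hs

theorem causalIntegrable_rlKernel (hβ : 0 < β) : CausalIntegrable (rlKernel β) :=
  .of_integrableOn_Ioc (causal_rlKernel β) fun T _ =>
    IntegrableOn.congr_fun ((intervalIntegral.intervalIntegrable_rpow' (a := 0) (b := T)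
      (r := β - 1) (by linarith)).1.div_const (Real.Gamma β))
      (fun _ hs => (rlKernel_of_pos hs.1).symm) measurableSet_Ioc

theorem integrable_temperedKernel (hβ : 0 < β) : Integrable (temperedKernel β) := by
  have h := (integrable_indicator_iff measurableSet_Ioi).2
    ((Real.GammaIntegral_convergent hβ).div_const (Real.Gamma β))
  refine h.congr (Eventually.of_forall fun s => ?_)
  rcases le_or_gt s 0 with hs | hs
  · rw [temperedKernel_of_nonpos hs, indicator_of_notMem (by simpa using hs)]
  · rw [temperedKernel, rlKernel_of_pos hs, indicator_of_mem (mem_Ioi.2 hs), mul_div_assoc]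

theorem causalIntegrable_temperedKernel (hβ : 0 < β) : CausalIntegrable (temperedKernel β) :=
  .of_integrable (integrable_temperedKernel hβ) (causal_temperedKernel β)

theorem rlKernel_one_of_pos (ht : 0 < t) : rlKernel 1 t = 1 := by simp [rlKernel_of_pos ht]

theorem temperedKernel_one_of_pos (ht : 0 < t) : temperedKernel 1 t = Real.exp (-t) := by
  rw [temperedKernel, rlKernel_one_of_pos ht, mul_one]

theorem heaviside_ae_eq_rlKernel_one : heaviside =ᵐ[volume] rlKernel 1 := by
  filter_upwards [Measure.ae_ne volume 0] with s hs
  rcases lt_or_gt_of_ne hs with hs | hs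
  · simp [hs, rlKernel_of_nonpos hs.le]
  · simp [hs.le, rlKernel_one_of_pos hs]

theorem rlIntegral_eq_rlKernel_convolution {x y : ℝ → ℝ} (hy : Causal y) (ht : 0 ≤ t)
    (hxy : EqOn x y (Icc 0 t)) : rlIntegral β x t = (rlKernel β ⋆ y) t := by
  rw [(causal_rlKernel β).convolution_eq_intervalIntegral hy ht, rlIntegral,
    ← intervalIntegral.integral_const_mul]
  refine intervalIntegral.integral_congr_Ioo_of_le ht fun s hs => ?_
  rw [hxy (Ioo_subset_Icc_self hs), rlKernel_of_pos (sub_pos.2 hs.2), smul_eq_mul]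
  ring

theorem integral_rpow_mul_sub_rpow {a b : ℝ} (ha : 0 < a) (hb : 0 < b) (ht : 0 < t) :
    ∫ s in (0 : ℝ)..t, s ^ (a - 1) * (t - s) ^ (b - 1) =
      t ^ (a + b - 1) * (Real.Gamma a * Real.Gamma b / Real.Gamma (a + b)) := by
  have h := Complex.betaIntegral_scaled a b ht
  rw [Complex.betaIntegral_eq_Gamma_mul_div _ _ (by simpa) (by simpa)] at h
  apply Complex.ofReal_injective
  rw [← intervalIntegral.integral_ofReal]
  push_cast
  rw [Complex.ofReal_cpow ht.le, ← Complex.Gamma_ofReal, ← Complex.Gamma_ofReal,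
    ← Complex.Gamma_ofReal]
  push_cast
  rw [← h]
  refine intervalIntegral.integral_congr fun s hs => ?_
  rw [uIcc_of_le ht.le] at hs
  rw [Complex.ofReal_cpow hs.1, Complex.ofReal_cpow (sub_nonneg.2 hs.2)]
  push_cast
  rfl

theorem rlKernel_convolution_rlKernel {a b : ℝ} (ha : 0 < a) (hb : 0 < b) :
    rlKernel a ⋆ rlKernel b = rlKernel (a + b) := by
  funext t
  rcases le_or_gt t 0 with ht | ht
  · rw [(causal_rlKernel a).convolution_of_nonpos (causal_rlKernel b) ht, rlKernel_of_nonpos ht]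
  have hΓa := (Real.Gamma_pos_of_pos ha).ne'
  have hΓb := (Real.Gamma_pos_of_pos hb).ne'
  calc (rlKernel a ⋆ rlKernel b) t
      = ∫ s in (0 : ℝ)..t, rlKernel b (t - s) • rlKernel a s := by
        rw [convolution_mul_comm,
          (causal_rlKernel b).convolution_eq_intervalIntegral (causal_rlKernel a) ht.le]
    _ = ∫ s in (0 : ℝ)..t, (1 / (Real.Gamma a * Real.Gamma b)) *
          (s ^ (a - 1) * (t - s) ^ (b - 1)) := by
        refine intervalIntegral.integral_congr_Ioo_of_le ht.le fun s hs => ?_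
        rw [rlKernel_of_pos hs.1, rlKernel_of_pos (sub_pos.2 hs.2), smul_eq_mul]
        field_simp
    _ = rlKernel (a + b) t := by
        rw [intervalIntegral.integral_const_mul, integral_rpow_mul_sub_rpow ha hb ht,
          rlKernel_of_pos ht]
        field_simp

theorem temperedKernel_convolution_temperedKernel {a b : ℝ} (ha : 0 < a) (hb : 0 < b) :
    temperedKernel a ⋆ temperedKernel b = temperedKernel (a + b) := by
  funext t
  rw [temperedKernel, ← rlKernel_convolution_rlKernel ha hb, convolution_lsmul, convolution_lsmul,
    ← integral_const_mul]
  refine integral_congr_ae (Eventually.of_forall fun u => ?_)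
  have : Real.exp (-t) = Real.exp (-u) * Real.exp (-(t - u)) := by
    rw [← Real.exp_add]; ring_nf
  simp only [temperedKernel, smul_eq_mul, this]
  ring

theorem one_sub_exp_neg_nonneg (ht : 0 ≤ t) : 0 ≤ 1 - Real.exp (-t) :=
  sub_nonneg.2 (Real.exp_le_one_iff.2 (by linarith))

theorem one_sub_exp_neg_le (t : ℝ) : 1 - Real.exp (-t) ≤ t := by
  linarith [Real.add_one_le_exp (-t)]

theorem correctionKernel_nonneg (hα0 : 0 < α) (hα1 : α < 1) (t : ℝ) : 0 ≤ correctionKernel α t := by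
  rcases le_or_gt t 0 with ht | ht
  · rw [correctionKernel_of_nonpos ht]
  · exact mul_nonneg (mul_nonneg hα0.le (rlKernel_nonneg (by linarith) t))
      (div_nonneg (one_sub_exp_neg_nonneg ht.le) ht.le)

theorem correctionKernel_le_rlKernel (hα0 : 0 < α) (hα1 : α < 1) (t : ℝ) :
    correctionKernel α t ≤ α * rlKernel (1 - α) t := by
  rcases le_or_gt t 0 with ht | ht
  · rw [correctionKernel_of_nonpos ht, rlKernel_of_nonpos ht, mul_zero]
  · exact mul_le_of_le_one_right (mul_nonneg hα0.le (rlKernel_nonneg (by linarith) t))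
      ((div_le_one ht).2 (one_sub_exp_neg_le t))

theorem correctionKernel_le_rpow (hα0 : 0 < α) (hα1 : α < 1) (ht : 0 < t) :
    correctionKernel α t ≤ α / Real.Gamma (1 - α) * t ^ (-1 - α) := by
  have hΓ : 0 < Real.Gamma (1 - α) := Real.Gamma_pos_of_pos (by linarith)
  calc correctionKernel α t
      = α / Real.Gamma (1 - α) * t ^ (-1 - α) * (1 - Real.exp (-t)) := by
        rw [correctionKernel, rlKernel_of_pos ht, show 1 - α - 1 = (-1 - α) + 1 by ring,
          Real.rpow_add_one ht.ne']
        field_simp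
    _ ≤ α / Real.Gamma (1 - α) * t ^ (-1 - α) :=
        mul_le_of_le_one_right (by positivity) (by linarith [Real.exp_pos (-t)])

theorem integrable_correctionKernel (hα0 : 0 < α) (hα1 : α < 1) :
    Integrable (correctionKernel α) := by
  have h_meas : AEStronglyMeasurable (correctionKernel α) :=
    (((measurable_rlKernel _).const_mul α).mul (by fun_prop)).aestronglyMeasurable
  have h_norm : ∀ t, ‖correctionKernel α t‖ = correctionKernel α t := fun t =>
    Real.norm_of_nonneg (correctionKernel_nonneg hα0 hα1 t)
  have near_zero : IntegrableOn (correctionKernel α) (Iic 1) :=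
    (((causalIntegrable_rlKernel (sub_pos.2 hα1)).integrableOn_Iic 1).const_mul α).mono'
      h_meas.restrict
      (Eventually.of_forall fun t => (h_norm t).trans_le (correctionKernel_le_rlKernel hα0 hα1 t))
  have near_infinity : IntegrableOn (correctionKernel α) (Ioi 1) := by
    refine ((integrableOn_Ioi_rpow_of_lt (a := -1 - α) (by linarith) one_pos).const_mul
      (α / Real.Gamma (1 - α))).mono'
      h_meas.restrict ((ae_restrict_iff' measurableSet_Ioi).2 (Eventually.of_forall fun t ht => ?_))
    exact (h_norm t).trans_le (correctionKernel_le_rpow hα0 hα1 (one_pos.trans ht))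
  simpa only [Iic_union_Ioi, integrableOn_univ] using near_zero.union near_infinity

theorem causalIntegrable_correctionKernel (hα0 : 0 < α) (hα1 : α < 1) :
    CausalIntegrable (correctionKernel α) :=
  .of_integrable (integrable_correctionKernel hα0 hα1) (causal_correctionKernel α)

theorem hasDerivAt_temperedKernel_sub_rlKernel (α : ℝ) (ht : 0 < t) :
    HasDerivAt (temperedKernel (1 - α) - rlKernel (1 - α))
      (correctionKernel α t - temperedKernel (1 - α) t) t := by
  have h := hasDerivAt_rlKernel (1 - α) ht
  refine (((hasDerivAt_neg t).exp.mul h).sub h).congr_deriv ?_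
  rw [correctionKernel, temperedKernel]
  ring

theorem abs_temperedKernel_sub_rlKernel_le (hβ : 0 < β) (t : ℝ) :
    |temperedKernel β t - rlKernel β t| ≤ |t| ^ β / Real.Gamma β := by
  have := Real.Gamma_pos_of_pos hβ
  rcases le_or_gt t 0 with ht | ht
  · rw [temperedKernel_of_nonpos ht, rlKernel_of_nonpos ht, sub_self, abs_zero]
    positivity
  · calc |temperedKernel β t - rlKernel β t|
        = (1 - Real.exp (-t)) * (t ^ (β - 1) / Real.Gamma β) := by
          rw [temperedKernel, rlKernel_of_pos ht, abs_sub_comm, ← one_sub_mul,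
            abs_of_nonneg (mul_nonneg (one_sub_exp_neg_nonneg ht.le) (by positivity))]
      _ ≤ t * (t ^ (β - 1) / Real.Gamma β) := by
          gcongr
          exact one_sub_exp_neg_le t
      _ = |t| ^ β / Real.Gamma β := by
          rw [abs_of_pos ht, Real.rpow_sub_one ht.ne']
          field_simp

theorem continuousOn_temperedKernel_sub_rlKernel (hα1 : α < 1) :
    ContinuousOn (temperedKernel (1 - α) - rlKernel (1 - α)) (Ici 0) := by
  intro t ht
  rcases (mem_Ici.1 ht).eq_or_lt with rfl | ht
  · have bound : Tendsto (fun s : ℝ => |s| ^ (1 - α) / Real.Gamma (1 - α)) (𝓝[Ici 0] 0) (𝓝 0) := by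
      have : ContinuousAt (fun s : ℝ => |s| ^ (1 - α) / Real.Gamma (1 - α)) 0 :=
        (continuous_abs.continuousAt.rpow_const (Or.inr (by linarith))).div_const _
      simpa [Real.zero_rpow (sub_pos.2 hα1).ne'] using this.tendsto.mono_left nhdsWithin_le_nhds
    have value : (temperedKernel (1 - α) - rlKernel (1 - α)) 0 = 0 := by
      simp [temperedKernel_of_nonpos, rlKernel_of_nonpos]
    rw [ContinuousWithinAt, value]
    exact squeeze_zero_norm (fun s => abs_temperedKernel_sub_rlKernel_le (sub_pos.2 hα1) s) bound
  · exact (hasDerivAt_temperedKernel_sub_rlKernel α ht).continuousAt.continuousWithinAt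

theorem integral_correctionKernel_sub_temperedKernel (hα0 : 0 < α) (hα1 : α < 1) (ht : 0 ≤ t) :
    ∫ s in (0 : ℝ)..t, (correctionKernel α s - temperedKernel (1 - α) s) =
      temperedKernel (1 - α) t - rlKernel (1 - α) t := by
  rw [intervalIntegral.integral_eq_sub_of_hasDerivAt_of_le ht
    ((continuousOn_temperedKernel_sub_rlKernel hα1).mono Icc_subset_Ici_self)
    (fun s hs => hasDerivAt_temperedKernel_sub_rlKernel α hs.1)
    ((integrable_correctionKernel hα0 hα1).sub
      (integrable_temperedKernel (sub_pos.2 hα1))).intervalIntegrable]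
  simp [temperedKernel_of_nonpos, rlKernel_of_nonpos]

theorem rlKernel_add_heaviside_convolution_correctionKernel (hα0 : 0 < α) (hα1 : α < 1) :
    rlKernel (1 - α) + heaviside ⋆ correctionKernel α =
      temperedKernel (1 - α) + heaviside ⋆ temperedKernel (1 - α) := by
  have hn := causal_correctionKernel α
  have hq := causal_temperedKernel (1 - α)
  funext t
  rcases lt_or_ge t 0 with ht | ht
  · simp only [Pi.add_apply, causal_rlKernel _ t ht, hq t ht,
      causalContinuous_heaviside.causal.convolution hn t ht,
      causalContinuous_heaviside.causal.convolution hq t ht]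
  · have h := integral_correctionKernel_sub_temperedKernel hα0 hα1 ht
    rw [intervalIntegral.integral_sub (integrable_correctionKernel hα0 hα1).intervalIntegrable
      (integrable_temperedKernel (sub_pos.2 hα1)).intervalIntegrable] at h
    rw [Pi.add_apply, Pi.add_apply, heaviside_convolution hn ht, heaviside_convolution hq ht]
    linarith

theorem temperedKernel_one_add_heaviside_convolution :
    temperedKernel 1 + heaviside ⋆ temperedKernel 1 =ᵐ[volume] heaviside := by
  filter_upwards [Measure.ae_ne volume 0] with t ht
  rw [Pi.add_apply]
  rcases lt_or_gt_of_ne ht with ht | ht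
  · rw [causal_temperedKernel 1 t ht,
      causalContinuous_heaviside.causal.convolution (causal_temperedKernel 1) t ht]
    simp [ht]
  · rw [heaviside_convolution (causal_temperedKernel 1) ht.le, temperedKernel_one_of_pos ht,
      intervalIntegral.integral_congr_Ioo_of_le ht.le fun s hs => temperedKernel_one_of_pos hs.1]
    simp [ht.le]

/-- In terms of Laplace transforms, with `z = (1 + s) ^ (-α) w`, this is the identity
`s ^ (α - 1) z + s⁻¹ ((1 + s) ^ α - s ^ α) z = s⁻¹ w`. -/
theorem rlKernel_convolution_temperedKernel_convolution {E : Type*} [NormedAddCommGroup E]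
    [NormedSpace ℝ E] [CompleteSpace E] {w : ℝ → E} (hα0 : 0 < α) (hα1 : α < 1)
    (hw : CausalContinuous w) :
    rlKernel (1 - α) ⋆ (temperedKernel α ⋆ w) +
      heaviside ⋆ (correctionKernel α ⋆ (temperedKernel α ⋆ w)) = heaviside ⋆ w := by
  have hH := causalContinuous_heaviside.causalIntegrable
  have hk := causalIntegrable_rlKernel (sub_pos.2 hα1)
  have hn := causalIntegrable_correctionKernel hα0 hα1
  have hq := causalIntegrable_temperedKernel hα0
  have hρ := causalIntegrable_temperedKernel (sub_pos.2 hα1)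
  have he := causalIntegrable_temperedKernel one_pos
  have hz := CausalContinuous.convolution hq hw
  set z := temperedKernel α ⋆ w with z_def
  have hρz : temperedKernel (1 - α) ⋆ z = temperedKernel 1 ⋆ w := by
    rw [z_def, ← hρ.convolution_assoc hq hw,
      temperedKernel_convolution_temperedKernel (sub_pos.2 hα1) hα0, sub_add_cancel]
  calc rlKernel (1 - α) ⋆ z + heaviside ⋆ (correctionKernel α ⋆ z)
      = (rlKernel (1 - α) + heaviside ⋆ correctionKernel α) ⋆ z := by
        rw [(hk.convolutionExists hz).add_distrib ((hH.convolution hn).convolutionExists hz),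
          hH.convolution_assoc hn hz]
    _ = (temperedKernel (1 - α) + heaviside ⋆ temperedKernel (1 - α)) ⋆ z := by
        rw [rlKernel_add_heaviside_convolution_correctionKernel hα0 hα1]
    _ = (temperedKernel 1 + heaviside ⋆ temperedKernel 1) ⋆ w := by
        rw [(hρ.convolutionExists hz).add_distrib ((hH.convolution hρ).convolutionExists hz),
          hH.convolution_assoc hρ hz, hρz,
          (he.convolutionExists hw).add_distrib ((hH.convolution he).convolutionExists hw),
          hH.convolution_assoc he hw]
    _ = heaviside ⋆ w :=
        convolution_congr _ temperedKernel_one_add_heaviside_convolution EventuallyEq.rfl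

end Kernels

/-! ### Laplace transforms -/

section LaplaceTransform

variable {a : ℝ → ℝ} {s : ℂ} {α β c : ℝ}

/-- The Laplace transform `∫ a(t) exp (-s t) dt`, for functions `a` that vanish on `(-∞, 0)`. -/
noncomputable def laplaceTransform (a : ℝ → ℝ) (s : ℂ) : ℂ :=
  ∫ t : ℝ, (a t : ℂ) * Complex.exp (-(s * t))

theorem norm_ofReal_mul_cexp_neg (r : ℝ) (s : ℂ) (t : ℝ) :
    ‖(r : ℂ) * Complex.exp (-(s * t))‖ = |r| * Real.exp (-(s.re * t)) := by
  rw [norm_mul, Complex.norm_exp, Complex.norm_real, Real.norm_eq_abs, Complex.neg_re,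
    Complex.re_mul_ofReal]

theorem Causal.norm_mul_cexp_neg_le (h0 : Causal a) (hs : 0 ≤ s.re) (t : ℝ) :
    ‖(a t : ℂ) * Complex.exp (-(s * t))‖ ≤ |a t| := by
  rw [norm_ofReal_mul_cexp_neg]
  rcases lt_or_ge t 0 with ht | ht
  · rw [h0 t ht, abs_zero, zero_mul]
  · exact mul_le_of_le_one_right (abs_nonneg _)
      (Real.exp_le_one_iff.2 (neg_nonpos.2 (mul_nonneg hs ht)))

theorem aestronglyMeasurable_mul_cexp_neg (ha : AEStronglyMeasurable a) (s : ℂ) :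
    AEStronglyMeasurable fun t : ℝ => (a t : ℂ) * Complex.exp (-(s * t)) :=
  (Complex.continuous_ofReal.comp_aestronglyMeasurable ha).mul
    (Continuous.aestronglyMeasurable (by fun_prop))

theorem Causal.integrable_mul_cexp_neg (h0 : Causal a) (ha : Integrable a) (hs : 0 ≤ s.re) :
    Integrable fun t : ℝ => (a t : ℂ) * Complex.exp (-(s * t)) :=
  ha.norm.mono' (aestronglyMeasurable_mul_cexp_neg ha.aestronglyMeasurable s)
    (Eventually.of_forall (h0.norm_mul_cexp_neg_le hs))

theorem Causal.continuousOn_laplaceTransform (h0 : Causal a) (ha : Integrable a) :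
    ContinuousOn (laplaceTransform a) {s | 0 ≤ s.re} :=
  continuousOn_of_dominated
    (fun s _ => aestronglyMeasurable_mul_cexp_neg ha.aestronglyMeasurable s)
    (fun _ hs => Eventually.of_forall (h0.norm_mul_cexp_neg_le hs)) ha.norm
    (Eventually.of_forall fun _ => by fun_prop)

theorem integrable_rlKernel_mul_exp (hβ : 0 < β) (hc : 0 < c) :
    Integrable fun t => rlKernel β t * Real.exp (-(c * t)) := by
  have h := (integrableOn_rpow_mul_exp_neg_mul_rpow (p := 1) (show -1 < β - 1 by linarith) one_pos
    hc).div_const (Real.Gamma β)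
  refine ((integrable_indicator_iff measurableSet_Ioi).2 h).congr
    (Eventually.of_forall fun t => ?_)
  by_cases ht : t ∈ Ioi 0
  · simp only [indicator_of_mem ht, rlKernel_of_pos ht, Real.rpow_one, neg_mul]
    ring
  · simp only [indicator_of_notMem ht, rlKernel_of_nonpos (not_lt.1 ht), zero_mul]

theorem integral_rlKernel_mul_exp (hβ : 0 < β) (hc : 0 < c) :
    ∫ t, rlKernel β t * Real.exp (-(c * t)) = c ^ (-β) := by
  have hΓ := (Real.Gamma_pos_of_pos hβ).ne'
  calc ∫ t, rlKernel β t * Real.exp (-(c * t))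
      = ∫ t in Ioi 0, rlKernel β t * Real.exp (-(c * t)) :=
        (setIntegral_eq_integral_of_forall_compl_eq_zero fun t ht => by
          rw [rlKernel_of_nonpos (not_lt.1 ht), zero_mul]).symm
    _ = ∫ t in Ioi 0, (1 / Real.Gamma β) * (t ^ (β - 1) * Real.exp (-(c * t))) :=
        setIntegral_congr_fun measurableSet_Ioi fun t ht => by
          rw [rlKernel_of_pos ht]
          ring
    _ = c ^ (-β) := by
        rw [integral_const_mul, Real.integral_rpow_mul_exp_neg_mul_Ioi hβ hc, one_div c,
          Real.inv_rpow hc.le, ← Real.rpow_neg hc.le]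
        field_simp

theorem integrable_rlKernel_mul_cexp_neg (hβ : 0 < β) (hs : 0 < s.re) :
    Integrable fun t : ℝ => (rlKernel β t : ℂ) * Complex.exp (-(s * t)) :=
  (integrable_rlKernel_mul_exp hβ hs).mono'
    (aestronglyMeasurable_mul_cexp_neg (measurable_rlKernel β).aestronglyMeasurable s)
    (Eventually.of_forall fun t => by
      rw [norm_ofReal_mul_cexp_neg, abs_of_nonneg (rlKernel_nonneg hβ t)])

theorem analyticOnNhd_laplaceTransform_rlKernel (hβ : 0 < β) :
    AnalyticOnNhd ℂ (laplaceTransform (rlKernel β)) {s | 0 < s.re} := by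
  set μ : Measure ℝ := volume.withDensity fun t => ENNReal.ofReal (rlKernel β t) with hμ
  have h_meas : Measurable fun t => ENNReal.ofReal (rlKernel β t) :=
    (measurable_rlKernel β).ennreal_ofReal
  have h_fin : ∀ᵐ t, ENNReal.ofReal (rlKernel β t) < ∞ :=
    Eventually.of_forall fun _ => ENNReal.ofReal_lt_top
  have h_eq : laplaceTransform (rlKernel β) = fun s => ProbabilityTheory.complexMGF id μ (-s) := by
    funext s
    rw [ProbabilityTheory.complexMGF, hμ,
      integral_withDensity_eq_integral_toReal_smul h_meas h_fin, laplaceTransform]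
    simp only [ENNReal.toReal_ofReal (rlKernel_nonneg hβ _), Complex.real_smul, id_eq, neg_mul]
  have h_sub : Iio 0 ⊆ interior (ProbabilityTheory.integrableExpSet id μ) := by
    refine interior_maximal (fun c hc => ?_) isOpen_Iio
    refine (integrable_withDensity_iff_integrable_smul' h_meas h_fin).2 ?_
    simpa only [ENNReal.toReal_ofReal (rlKernel_nonneg hβ _), smul_eq_mul, neg_mul, neg_neg, id_eq]
      using integrable_rlKernel_mul_exp hβ (neg_pos.2 hc)
  rw [h_eq]
  intro s hs
  exact (ProbabilityTheory.analyticOnNhd_complexMGF (-s) (h_sub (by simpa using hs))).comp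
    analyticAt_id.neg

theorem laplaceTransform_rlKernel (hβ : 0 < β) (hs : 0 < s.re) :
    laplaceTransform (rlKernel β) s = s ^ (-(β : ℂ)) := by
  have h_cpow : AnalyticOnNhd ℂ (fun s : ℂ => s ^ (-(β : ℂ))) {s | 0 < s.re} :=
    fun s hs => analyticAt_id.cpow analyticAt_const (Or.inl hs)
  have h_real : ∀ c : ℝ, 0 < c → laplaceTransform (rlKernel β) c = (c : ℂ) ^ (-(β : ℂ)) := by
    intro c hc
    rw [laplaceTransform, ← Complex.ofReal_neg, ← Complex.ofReal_cpow hc.le,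
      ← integral_rlKernel_mul_exp hβ hc, ← integral_complex_ofReal]
    push_cast
    rfl
  have h_map : Tendsto (fun c : ℝ => (c : ℂ)) (𝓝[≠] 1) (𝓝[≠] 1) :=
    (Complex.continuous_ofReal.tendsto' 1 1 Complex.ofReal_one).inf
      (tendsto_principal_principal.2 fun c hc => by simpa using hc)
  have h_pos : ∀ᶠ c : ℝ in 𝓝[≠] 1, 0 < c := nhdsWithin_le_nhds (Ioi_mem_nhds one_pos)
  exact (analyticOnNhd_laplaceTransform_rlKernel hβ).eqOn_of_preconnected_of_frequently_eq h_cpow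
    (convex_halfSpace_re_gt 0).isPreconnected (z₀ := 1) (by simp)
    (h_map.frequently (h_pos.mono h_real).frequently) hs

theorem laplaceTransform_temperedKernel (hβ : 0 < β) (hs : 0 ≤ s.re) :
    laplaceTransform (temperedKernel β) s = (1 + s) ^ (-(β : ℂ)) := by
  rw [← laplaceTransform_rlKernel hβ (by simp; linarith)]
  refine integral_congr_ae (Eventually.of_forall fun t => ?_)
  simp only [temperedKernel]
  push_cast
  rw [show -((1 + s) * (t : ℂ)) = -t + -(s * t) by ring, Complex.exp_add]
  ring

theorem laplaceTransform_sub {b : ℝ → ℝ}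
    (ha : Integrable fun t : ℝ => (a t : ℂ) * Complex.exp (-(s * t)))
    (hb : Integrable fun t : ℝ => (b t : ℂ) * Complex.exp (-(s * t))) :
    laplaceTransform (a - b) s = laplaceTransform a s - laplaceTransform b s := by
  simp only [laplaceTransform, ← integral_sub ha hb, Pi.sub_apply, Complex.ofReal_sub, sub_mul]

theorem laplaceTransform_deriv {u u' : ℝ → ℝ} (hu : ∀ t ≤ 0, u t = 0) (hu' : ∀ t ≤ 0, u' t = 0)
    (h_cont : ContinuousWithinAt u (Ici 0) 0) (h_deriv : ∀ t > 0, HasDerivAt u (u' t) t)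
    (h_int : Integrable fun t : ℝ => (u t : ℂ) * Complex.exp (-(s * t)))
    (h_int' : Integrable fun t : ℝ => (u' t : ℂ) * Complex.exp (-(s * t))) :
    laplaceTransform u' s = s * laplaceTransform u s := by
  set f : ℝ → ℂ := fun t => u t * Complex.exp (-(s * t))
  set f' : ℝ → ℂ := fun t => u' t * Complex.exp (-(s * t)) - s * f t
  have h_exp : ∀ t : ℝ,
      HasDerivAt (fun t : ℝ => Complex.exp (-(s * t))) (-s * Complex.exp (-(s * t))) t := fun t =>
    (((hasDerivAt_id (t : ℂ)).const_mul s).neg.cexp.comp_ofReal).congr_deriv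
      (by simp only [Pi.neg_apply, id_eq, mul_one, neg_mul]; ring)
  have hf : ∀ t ∈ Ioi (0 : ℝ), HasDerivAt f (f' t) t := fun t ht =>
    ((h_deriv t ht).ofReal_comp.mul (h_exp t)).congr_deriv (by simp only [f', f]; ring)
  have hf0 : ContinuousWithinAt f (Ici 0) 0 :=
    (Complex.continuous_ofReal.continuousAt.comp_continuousWithinAt h_cont).mul
      (h_exp 0).continuousAt.continuousWithinAt
  have hf'_int : Integrable f' := h_int'.sub (h_int.const_mul s)
  have h_zero : ∫ t, f' t = 0 := by
    rw [← setIntegral_eq_integral_of_forall_compl_eq_zero (s := Ioi 0) fun t ht => by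
        simp only [f', f, hu t (not_lt.1 ht), hu' t (not_lt.1 ht), Complex.ofReal_zero, zero_mul,
          mul_zero, sub_zero],
      integral_Ioi_of_hasDerivAt_of_tendsto hf0 hf hf'_int.integrableOn
        (tendsto_zero_of_hasDerivAt_of_integrableOn_Ioi hf hf'_int.integrableOn
          h_int.integrableOn)]
    simp only [f, hu 0 le_rfl, Complex.ofReal_zero, zero_mul, sub_zero]
  refine sub_eq_zero.1 (Eq.trans ?_ h_zero)
  rw [integral_sub h_int' (h_int.const_mul s), integral_const_mul]
  rfl

theorem laplaceTransform_correctionKernel_sub (hα0 : 0 < α) (hα1 : α < 1) (hs : 0 < s.re) :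
    laplaceTransform (correctionKernel α) s - laplaceTransform (temperedKernel (1 - α)) s =
      s * (laplaceTransform (temperedKernel (1 - α)) s -
        laplaceTransform (rlKernel (1 - α)) s) := by
  have hβ : 0 < 1 - α := sub_pos.2 hα1
  have h_corr := (causal_correctionKernel α).integrable_mul_cexp_neg
    (integrable_correctionKernel hα0 hα1) hs.le
  have h_temp := (causal_temperedKernel (1 - α)).integrable_mul_cexp_neg
    (integrable_temperedKernel hβ) hs.le
  have h_rl := integrable_rlKernel_mul_cexp_neg hβ hs
  rw [← laplaceTransform_sub h_corr h_temp, ← laplaceTransform_sub h_temp h_rl]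
  refine laplaceTransform_deriv
    (fun t ht => sub_eq_zero.2 ((temperedKernel_of_nonpos ht).trans (rlKernel_of_nonpos ht).symm))
    (fun t ht => sub_eq_zero.2
      ((correctionKernel_of_nonpos ht).trans (temperedKernel_of_nonpos ht).symm))
    (continuousOn_temperedKernel_sub_rlKernel hα1 0 self_mem_Ici)
    (fun t ht => hasDerivAt_temperedKernel_sub_rlKernel α ht) ?_ ?_
  · exact (h_temp.sub h_rl).congr (Eventually.of_forall fun t => by simp [sub_mul])
  · exact (h_corr.sub h_temp).congr (Eventually.of_forall fun t => by simp [sub_mul])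

theorem one_add_ne_zero_of_re_nonneg (hs : 0 ≤ s.re) : 1 + s ≠ 0 := fun h => by
  have h_re := congrArg Complex.re h
  simp only [Complex.add_re, Complex.one_re, Complex.zero_re] at h_re
  linarith

theorem laplaceTransform_correctionKernel (hα0 : 0 < α) (hα1 : α < 1) (hs : 0 ≤ s.re) :
    laplaceTransform (correctionKernel α) s = (1 + s) ^ (α : ℂ) - s ^ (α : ℂ) := by
  have hβ : 0 < 1 - α := sub_pos.2 hα1
  have h_open : EqOn (laplaceTransform (correctionKernel α))
      (fun s => (1 + s) ^ (α : ℂ) - s ^ (α : ℂ)) {s | 0 < s.re} := fun s (hs : 0 < s.re) => by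
    have h_one : 1 + s ≠ 0 := one_add_ne_zero_of_re_nonneg hs.le
    have h_zero : s ≠ 0 := fun h => by simp [h] at hs
    have h_exponent : -(((1 - α : ℝ)) : ℂ) = α - 1 := by push_cast; ring
    have h := laplaceTransform_correctionKernel_sub hα0 hα1 hs
    rw [laplaceTransform_temperedKernel hβ hs.le, laplaceTransform_rlKernel hβ hs, h_exponent,
      Complex.cpow_sub _ _ h_one, Complex.cpow_sub _ _ h_zero, Complex.cpow_one, Complex.cpow_one,
      sub_eq_iff_eq_add] at h
    rw [h]
    field_simp
    ring
  have h_cpow : ∀ z : ℂ, 0 ≤ z.re → ContinuousAt (fun z : ℂ => z ^ (α : ℂ)) z := fun z hz =>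
    Complex.continuousAt_cpow_const_of_re_pos (Or.inl hz) (by simpa using hα0)
  refine h_open.of_subset_closure ((causal_correctionKernel α).continuousOn_laplaceTransform
    (integrable_correctionKernel hα0 hα1)) (fun s hs => ContinuousAt.continuousWithinAt ?_)
    (fun s (hs : 0 < s.re) => hs.le) (Complex.closure_setOfPred_lt_re 0).ge hs
  exact (ContinuousAt.comp (f := (1 + · : ℂ → ℂ)) (h_cpow (1 + s) (by simp; linarith [hs.out]))
    (by fun_prop)).sub (h_cpow s hs)

end LaplaceTransform

/-! ### The characteristic equation and the stability region -/

theorem abs_arg_exp_le (z : ℂ) : |(Complex.exp z).arg| ≤ |z.im| := by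
  by_cases h : z.im ∈ Ioc (-Real.pi) Real.pi
  · rw [Complex.arg_exp, (toIocMod_eq_self Real.two_pi_pos).2 ⟨h.1, by linarith [h.2]⟩]
  · refine (Complex.abs_arg_le_pi _).trans (le_of_not_gt fun hlt => h ?_)
    exact ⟨(abs_lt.1 hlt).1, (abs_lt.1 hlt).2.le⟩

theorem abs_arg_cpow_mul_exp_le {α τ : ℝ} (hα : 0 ≤ α) (hτ : 0 ≤ τ) {s : ℂ} (hs : 0 ≤ s.re)
    (hs0 : s ≠ 0) :
    |(s ^ (α : ℂ) * Complex.exp (s * τ)).arg| ≤ α * (Real.pi / 2) + ‖s‖ * τ := by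
  rw [Complex.cpow_def_of_ne_zero hs0, ← Complex.exp_add]
  calc |(Complex.exp (Complex.log s * α + s * τ)).arg|
      ≤ |(Complex.log s * α + s * τ).im| := abs_arg_exp_le _
    _ = |α * s.arg + s.im * τ| := by
        rw [Complex.add_im, Complex.im_mul_ofReal, Complex.im_mul_ofReal, Complex.log_im, mul_comm]
    _ ≤ α * |s.arg| + |s.im| * τ := by
        refine (abs_add_le _ _).trans_eq ?_
        rw [abs_mul, abs_mul, abs_of_nonneg hα, abs_of_nonneg hτ]
    _ ≤ α * (Real.pi / 2) + ‖s‖ * τ := by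
        gcongr
        · exact Complex.abs_arg_le_pi_div_two_iff.2 hs
        · exact Complex.abs_im_le_norm s

theorem rpow_norm_le_norm_cpow_mul_exp {α τ : ℝ} (hτ : 0 ≤ τ) {s : ℂ} (hs : 0 ≤ s.re)
    (hs0 : s ≠ 0) : ‖s‖ ^ α ≤ ‖s ^ (α : ℂ) * Complex.exp (s * τ)‖ := by
  rw [norm_mul, Complex.norm_exp, Complex.norm_cpow_of_ne_zero hs0, Complex.re_mul_ofReal,
    Complex.ofReal_re, Complex.ofReal_im, mul_zero, Real.exp_zero, div_one]
  exact le_mul_of_one_le_right (by positivity) (Real.one_le_exp (mul_nonneg hs hτ))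

/-- The characteristic function `s ^ α - λ exp (-s τ)` has no zero in the closed right half-plane
when `λ` lies in the stability region. -/
theorem cpow_mul_exp_notMem_stabilityRegion {α τ : ℝ} (hα : 0 < α) (hτ : 0 < τ)
    {s : ℂ} (hs : 0 ≤ s.re) :
    s ^ (α : ℂ) * Complex.exp (s * τ) ∉ stabilityRegion α τ := by
  rintro ⟨h_ne, h_norm, h_arg, -⟩
  have hs0 : s ≠ 0 := by
    rintro rfl
    exact h_ne (by rw [Complex.zero_cpow (by exact_mod_cast hα.ne'), zero_mul])
  have h_base : 0 ≤ (|(s ^ (α : ℂ) * Complex.exp (s * τ)).arg| - α * Real.pi / 2) / τ :=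
    div_nonneg (by linarith) hτ.le
  have h_lt := (Real.rpow_lt_rpow_iff (norm_nonneg s) h_base hα).1
    ((rpow_norm_le_norm_cpow_mul_exp hτ.le hs hs0).trans_lt h_norm)
  rw [lt_div_iff₀ hτ] at h_lt
  linarith [abs_arg_cpow_mul_exp_le hα.le hτ.le hs hs0]

/-! ### Bounded characters of the half-line -/

section HalfLine

variable {f : ℝ → ℂ}

theorem eq_mul_exp_of_hasDerivAt (c : ℂ) (h : ∀ t ≥ 0, HasDerivAt f (c * f t) t)
    {t : ℝ} (ht : 0 ≤ t) : f t = f 0 * Complex.exp (c * t) := by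
  have h_exp : ∀ t : ℝ,
      HasDerivAt (fun t : ℝ => Complex.exp (-(c * t))) (-c * Complex.exp (-(c * t))) t := fun t =>
    (((hasDerivAt_id (t : ℂ)).const_mul c).neg.cexp.comp_ofReal).congr_deriv
      (by simp only [Pi.neg_apply, id_eq, mul_one, neg_mul]; ring)
  have h_prod : ∀ t ≥ 0, HasDerivAt (fun t => f t * Complex.exp (-(c * t))) 0 t := fun t ht =>
    ((h t ht).mul (h_exp t)).congr_deriv (by ring)
  have h_const := constant_of_has_deriv_right_zero
    (fun s hs => (h_prod s hs.1).continuousAt.continuousWithinAt)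
    (fun s hs => (h_prod s hs.1).hasDerivWithinAt) t ⟨ht, le_rfl⟩
  rw [Complex.ofReal_zero, mul_zero, neg_zero, Complex.exp_zero, mul_one, Complex.exp_neg]
    at h_const
  rw [← h_const, inv_mul_cancel_right₀ (Complex.exp_ne_zero _)]

theorem integral_Ioi_of_mul (hmul : ∀ u v, 0 ≤ u → 0 ≤ v → f (u + v) = f u * f v)
    {h : ℝ} (hh : 0 ≤ h) : ∫ u in Ioi h, f u = f h * ∫ u in Ioi (0 : ℝ), f u := by
  calc ∫ u in Ioi h, f u = ∫ u in Ioi 0, f (h + u) := by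
        rw [← (measurePreserving_add_left volume h).setIntegral_preimage_emb
          (measurableEmbedding_addLeft h), preimage_const_add_Ioi, sub_self]
    _ = ∫ u in Ioi 0, f h * f u :=
        setIntegral_congr_fun measurableSet_Ioi fun u hu => hmul h u hh (mem_Ioi.1 hu).le
    _ = f h * ∫ u in Ioi 0, f u := integral_const_mul _ _

/-- The semigroup law makes the tail integral a multiple of `f`, so that `f` solves a linear
differential equation. -/
theorem exists_eq_exp_of_mul_of_integral_ne_zero (hf : Continuous f)
    (hmul : ∀ u v, 0 ≤ u → 0 ≤ v → f (u + v) = f u * f v) (hint : IntegrableOn f (Ioi 0))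
    (hr : ∫ u in Ioi (0 : ℝ), f u ≠ 0) :
    ∃ c : ℂ, ∀ u : ℝ, 0 ≤ u → f u = Complex.exp (c * u) := by
  set r := ∫ u in Ioi (0 : ℝ), f u
  set F : ℝ → ℂ := fun h => r⁻¹ * (r - ∫ u in (0 : ℝ)..h, f u)
  have h_tail : ∀ h, 0 ≤ h → F h = f h := fun h hh => by
    have h_sub := intervalIntegral.integral_Ioi_sub_Ioi hint hh
    rw [integral_Ioi_of_mul hmul hh] at h_sub
    simp only [F, ← h_sub]
    rw [sub_sub_cancel, inv_mul_eq_iff_eq_mul₀ hr, mul_comm]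
  have h_deriv : ∀ h ≥ 0, HasDerivAt F (-r⁻¹ * F h) h := fun h hh => by
    rw [h_tail h hh, neg_mul, ← mul_neg]
    exact ((hf.integral_hasStrictDerivAt 0 h).hasDerivAt.const_sub r).const_mul r⁻¹
  refine ⟨-r⁻¹, fun u hu => ?_⟩
  have h_zero : F 0 = 1 := by
    simp only [F, intervalIntegral.integral_same, sub_zero, inv_mul_cancel₀ hr]
  rw [← h_tail u hu, eq_mul_exp_of_hasDerivAt _ h_deriv hu, h_zero, one_mul]

theorem re_nonneg_of_norm_exp_neg_mul_le {s : ℂ} {C : ℝ}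
    (h : ∀ u : ℝ, 0 ≤ u → ‖Complex.exp (-(s * u))‖ ≤ C) : 0 ≤ s.re := by
  by_contra! hs
  have h_lim : Tendsto (fun u : ℝ => Real.exp (-(s.re * u))) atTop atTop :=
    Real.tendsto_exp_atTop.comp (by
      simpa only [neg_mul, id_eq] using tendsto_id.const_mul_atTop (neg_pos.2 hs))
  obtain ⟨u, hu, hu0⟩ := ((h_lim.eventually_gt_atTop C).and (eventually_ge_atTop 0)).exists
  have := h u hu0
  rw [Complex.norm_exp, Complex.neg_re, Complex.re_mul_ofReal] at this
  exact this.not_gt hu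

theorem exists_eq_exp_of_mul {m : ℝ → ℂ} (hm : Continuous m)
    (hmul : ∀ u v, 0 ≤ u → 0 ≤ v → m (u + v) = m u * m v) {C : ℝ} (hC : ∀ u, ‖m u‖ ≤ C)
    (hr : ∫ u in Ioi (0 : ℝ), Complex.exp (-u) * m u ≠ 0) :
    ∃ s : ℂ, 0 ≤ s.re ∧ ∀ u : ℝ, 0 ≤ u → m u = Complex.exp (-(s * u)) := by
  have h_cont : Continuous fun u : ℝ => Complex.exp (-u) * m u := by fun_prop
  have h_int : IntegrableOn (fun u : ℝ => Complex.exp (-u) * m u) (Ioi 0) := by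
    refine ((integrableOn_exp_neg_Ioi 0).mul_const C).mono' h_cont.aestronglyMeasurable
      (Eventually.of_forall fun u => ?_)
    rw [norm_mul, Complex.norm_exp, Complex.neg_re, Complex.ofReal_re]
    exact mul_le_mul_of_nonneg_left (hC u) (Real.exp_pos _).le
  have h_mul : ∀ u v : ℝ, 0 ≤ u → 0 ≤ v → Complex.exp (-(u + v : ℝ)) * m (u + v) =
      Complex.exp (-u) * m u * (Complex.exp (-v) * m v) := fun u v hu hv => by
    rw [hmul u v hu hv, Complex.ofReal_add, neg_add, Complex.exp_add]
    ring
  obtain ⟨c, hc⟩ := exists_eq_exp_of_mul_of_integral_ne_zero h_cont h_mul h_int hr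
  have h_exp : ∀ u : ℝ, 0 ≤ u → m u = Complex.exp (-(-(c + 1) * u)) := fun u hu => by
    rw [show -(-(c + 1) * (u : ℂ)) = u + c * u by ring, Complex.exp_add, ← hc u hu, ← mul_assoc,
      ← Complex.exp_add, add_neg_cancel, Complex.exp_zero, one_mul]
  exact ⟨-(c + 1), re_nonneg_of_norm_exp_neg_mul_le fun u hu => h_exp u hu ▸ hC u, h_exp⟩

end HalfLine

/-! ### The convolution algebra and its characters -/

/-- The subspace of `C₀(ℝ, ℂ)` underlying `DecaySpace`. -/
def decaySubmodule : Submodule ℂ (ZeroAtInftyContinuousMap ℝ ℂ) where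
  carrier := {f | ∀ t ≤ 0, f t = 0}
  zero_mem' _ _ := rfl
  add_mem' hf hg t ht := by simp [hf t ht, hg t ht]
  smul_mem' c f hf t ht := by simp [hf t ht]

theorem isClosed_decaySubmodule :
    IsClosed (decaySubmodule : Set (ZeroAtInftyContinuousMap ℝ ℂ)) := by
  have h_eval (t : ℝ) : Continuous fun f : ZeroAtInftyContinuousMap ℝ ℂ => f t :=
    (BoundedContinuousFunction.evalCLM ℂ t).continuous.comp
      ZeroAtInftyContinuousMap.isometry_toBCF.continuous
  change IsClosed {f : ZeroAtInftyContinuousMap ℝ ℂ | ∀ t ≤ 0, f t = 0}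
  simp only [Set.ofPred_forall]
  exact isClosed_iInter fun t => isClosed_iInter fun _ => isClosed_eq (h_eval t) continuous_const

/-- The Banach space of continuous functions on the line which vanish on `(-∞, 0]` and at
infinity: the decaying trajectories, extended by zero to the past. It is a type of its own, rather
than a coerced subspace, to keep instance search on operators between such spaces cheap. -/
def DecaySpace : Type := decaySubmodule

namespace DecaySpace

noncomputable instance : NormedAddCommGroup DecaySpace :=
  inferInstanceAs (NormedAddCommGroup decaySubmodule)

noncomputable instance : NormedSpace ℂ DecaySpace :=
  inferInstanceAs (NormedSpace ℂ decaySubmodule)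

instance : CompleteSpace DecaySpace := isClosed_decaySubmodule.completeSpace_coe

noncomputable instance : FunLike DecaySpace ℝ ℂ where
  coe f := f.1
  coe_injective _ _ h := Subtype.ext (DFunLike.coe_injective h)

/-- The element of `DecaySpace` given by a function. -/
noncomputable def ofFun (f : ℝ → ℂ) (hc : Continuous f) (h0 : ∀ t ≤ 0, f t = 0)
    (hl : Tendsto f atTop (𝓝 0)) : DecaySpace where
  val :=
    { toFun := f
      continuous_toFun := hc
      zero_at_infty' := by
        rw [cocompact_eq_atBot_atTop, tendsto_sup]
        refine ⟨tendsto_const_nhds.congr' ?_, hl⟩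
        filter_upwards [eventually_le_atBot 0] with t ht using (h0 t ht).symm }
  property := h0

variable (f : DecaySpace)

theorem continuous : Continuous f := f.1.continuous

theorem tendsto : Tendsto f atTop (𝓝 0) :=
  f.1.zero_at_infty'.mono_left atTop_le_cocompact

theorem apply_of_nonpos {t : ℝ} (ht : t ≤ 0) : f t = 0 := f.2 t ht

theorem causalContinuous : CausalContinuous f :=
  .of_continuous f.continuous fun _ ht => f.apply_of_nonpos ht.le

theorem norm_apply_le (t : ℝ) : ‖f t‖ ≤ ‖f‖ := f.1.toBCF.norm_coe_le_norm t

variable {f}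

@[ext] theorem ext {g : DecaySpace} (h : ∀ t, f t = g t) : f = g := DFunLike.ext _ _ h

theorem norm_le {C : ℝ} (hC : 0 ≤ C) (h : ∀ t, ‖f t‖ ≤ C) : ‖f‖ ≤ C :=
  (BoundedContinuousFunction.norm_le (f := f.1.toBCF) hC).2 h

/-- Evaluation at a point as a continuous linear functional. -/
noncomputable def evalCLM (t : ℝ) : DecaySpace →L[ℂ] ℂ :=
  LinearMap.mkContinuous
    { toFun := fun f => f t
      map_add' := fun _ _ => rfl
      map_smul' := fun _ _ => rfl } 1 fun f => (f.norm_apply_le t).trans_eq (one_mul _).symm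

end DecaySpace

/-- Causal kernels integrable on the whole line: those whose convolution preserves decay. -/
structure IntegrableKernel (a : ℝ → ℝ) : Prop where
  causal : Causal a
  integrable : Integrable a

theorem IntegrableKernel.causalIntegrable {a : ℝ → ℝ} (h : IntegrableKernel a) :
    CausalIntegrable a :=
  .of_integrable h.integrable h.causal

theorem integrableKernel_temperedKernel {β : ℝ} (hβ : 0 < β) :
    IntegrableKernel (temperedKernel β) :=
  ⟨causal_temperedKernel β, integrable_temperedKernel hβ⟩

theorem integrableKernel_correctionKernel {α : ℝ} (hα0 : 0 < α) (hα1 : α < 1) :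
    IntegrableKernel (correctionKernel α) :=
  ⟨causal_correctionKernel α, integrable_correctionKernel hα0 hα1⟩

section Operators

variable {a b : ℝ → ℝ}

/-- Convolution with an integrable kernel as an operator on `DecaySpace`. -/
noncomputable def convOp (h : IntegrableKernel a) : DecaySpace →L[ℂ] DecaySpace :=
  LinearMap.mkContinuous
    { toFun := fun f => DecaySpace.ofFun (a ⋆ f)
        (h.causalIntegrable.continuous_convolution f.causalContinuous)
        (fun _ ht => h.causal.convolution_of_nonpos f.causalContinuous.causal ht)
        (tendsto_convolution_atTop h.integrable f.continuous.aestronglyMeasurable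
          f.norm_apply_le f.tendsto)
      map_add' := fun f g => DFunLike.coe_injective <|
        (h.causalIntegrable.convolutionExists f.causalContinuous).distrib_add
          (h.causalIntegrable.convolutionExists g.causalContinuous)
      map_smul' := fun c f => DFunLike.coe_injective <| convolution_const_smul a c f }
    (∫ u, ‖a u‖) fun f => DecaySpace.norm_le (by positivity)
      (norm_convolution_le h.integrable f.norm_apply_le)

/-- Translation to the right by `|u|` as an operator on `DecaySpace`; the absolute value makes it
defined for every real `u`. -/
noncomputable def shiftOp (u : ℝ) : DecaySpace →L[ℂ] DecaySpace :=
  LinearMap.mkContinuous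
    { toFun := fun f => DecaySpace.ofFun (fun t => f (t - |u|))
        (f.continuous.comp (by fun_prop))
        (fun t ht => f.apply_of_nonpos (by linarith [abs_nonneg u]))
        (f.tendsto.comp (tendsto_atTop_add_const_right atTop (-|u|) tendsto_id))
      map_add' := fun _ _ => rfl
      map_smul' := fun _ _ => rfl }
    1 fun f => by
      rw [one_mul]
      exact DecaySpace.norm_le (norm_nonneg _) fun _ => f.norm_apply_le _

theorem coe_convOp_apply (h : IntegrableKernel a) (f : DecaySpace) :
    ⇑(convOp h f) = a ⋆ f := rfl

theorem shiftOp_apply (u : ℝ) (f : DecaySpace) (t : ℝ) : shiftOp u f t = f (t - |u|) := rfl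

theorem norm_shiftOp_le (u : ℝ) : ‖shiftOp u‖ ≤ 1 :=
  LinearMap.mkContinuous_norm_le _ zero_le_one _

theorem shiftOp_add {u v : ℝ} (hu : 0 ≤ u) (hv : 0 ≤ v) :
    shiftOp (u + v) = shiftOp u * shiftOp v := by
  ext f t
  simp only [ContinuousLinearMap.mul_def, ContinuousLinearMap.comp_apply, shiftOp_apply,
    abs_of_nonneg, hu, hv, add_nonneg, sub_sub]

theorem shiftOp_mul_comm (u v : ℝ) : shiftOp u * shiftOp v = shiftOp v * shiftOp u := by
  ext f t
  simp only [ContinuousLinearMap.mul_def, ContinuousLinearMap.comp_apply, shiftOp_apply,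
    sub_right_comm]

theorem convOp_mul_comm (ha : IntegrableKernel a) (hb : IntegrableKernel b) :
    convOp ha * convOp hb = convOp hb * convOp ha :=
  ContinuousLinearMap.ext fun f => DFunLike.coe_injective <|
    ha.causalIntegrable.convolution_left_comm hb.causalIntegrable f.causalContinuous

theorem shiftOp_mul_convOp (u : ℝ) (ha : IntegrableKernel a) :
    shiftOp u * convOp ha = convOp ha * shiftOp u := by
  ext f t
  exact (convolution_comp_sub_right a f |u| t).symm

theorem convOp_temperedKernel_mul {β γ : ℝ} (hβ : 0 < β) (hγ : 0 < γ) :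
    convOp (integrableKernel_temperedKernel hβ) * convOp (integrableKernel_temperedKernel hγ) =
      convOp (integrableKernel_temperedKernel (add_pos hβ hγ)) := by
  refine ContinuousLinearMap.ext fun f => DFunLike.coe_injective ?_
  simp only [ContinuousLinearMap.mul_def, ContinuousLinearMap.comp_apply, coe_convOp_apply]
  rw [← temperedKernel_convolution_temperedKernel hβ hγ,
    (causalIntegrable_temperedKernel hβ).convolution_assoc (causalIntegrable_temperedKernel hγ)
      f.causalContinuous]

end Operators

section Algebra

variable {a : ℝ → ℝ}

/-- The convolutions with integrable kernels and the shifts, generating the convolution algebra. -/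
def convGenerators : Set (DecaySpace →L[ℂ] DecaySpace) :=
  {T | ∃ (a : ℝ → ℝ) (h : IntegrableKernel a), T = convOp h} ∪ range shiftOp

theorem mul_comm_of_mem_convGenerators :
    ∀ S ∈ convGenerators, ∀ T ∈ convGenerators, S * T = T * S := by
  rintro S (⟨a, ha, rfl⟩ | ⟨u, rfl⟩) T (⟨b, hb, rfl⟩ | ⟨v, rfl⟩)
  · exact convOp_mul_comm ha hb
  · exact (shiftOp_mul_convOp v ha).symm
  · exact shiftOp_mul_convOp u hb
  · exact shiftOp_mul_comm u v

/-- The closed subalgebra of operators underlying `ConvAlgebra`. -/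
noncomputable def convSubalgebra : Subalgebra ℂ (DecaySpace →L[ℂ] DecaySpace) :=
  (Algebra.adjoin ℂ convGenerators).topologicalClosure

theorem convSubalgebra_mul_comm (S T : convSubalgebra) : S * T = T * S := by
  have hc := Algebra.isMulCommutative_adjoin ℂ mul_comm_of_mem_convGenerators
  exact (Subalgebra.commRingTopologicalClosure (Algebra.adjoin ℂ convGenerators)
    (fun x y => hc.is_comm.comm x y)).mul_comm S T

/-- The commutative Banach algebra of operators on `DecaySpace` generated by convolutions and
shifts. It is a type of its own so that it can carry a `NormedCommRing` instance. -/
def ConvAlgebra : Type := convSubalgebra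

namespace ConvAlgebra

noncomputable instance : NormedCommRing ConvAlgebra :=
  { (inferInstanceAs (NormedRing convSubalgebra) : NormedRing ConvAlgebra) with
    mul_comm := convSubalgebra_mul_comm }

noncomputable instance : NormedAlgebra ℂ ConvAlgebra :=
  { (inferInstanceAs (Algebra ℂ convSubalgebra) : Algebra ℂ ConvAlgebra) with
    norm_smul_le := fun c (T : convSubalgebra) => norm_smul_le c T.1 }

instance : CompleteSpace ConvAlgebra :=
  (Subalgebra.isClosed_topologicalClosure (Algebra.adjoin ℂ convGenerators)).completeSpace_coe

/-- The operator underlying an element of the convolution algebra. -/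
noncomputable def toOp : ConvAlgebra →L[ℂ] (DecaySpace →L[ℂ] DecaySpace) :=
  LinearMap.mkContinuous
    { toFun := fun T => T.1
      map_add' := fun _ _ => rfl
      map_smul' := fun _ _ => rfl } 1 fun T => (one_mul ‖T‖).symm.le

theorem toOp_injective : Function.Injective toOp := Subtype.val_injective

theorem toOp_one : toOp 1 = 1 := rfl

theorem toOp_mul (S T : ConvAlgebra) : toOp (S * T) = toOp S * toOp T := rfl

end ConvAlgebra

/-- Convolution with an integrable kernel as an element of the convolution algebra. -/
noncomputable def convElt (h : IntegrableKernel a) : ConvAlgebra :=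
  ⟨convOp h, Subalgebra.le_topologicalClosure _ (Algebra.subset_adjoin (Or.inl ⟨a, h, rfl⟩))⟩

/-- Translation to the right by `|u|` as an element of the convolution algebra. -/
noncomputable def shiftElt (u : ℝ) : ConvAlgebra :=
  ⟨shiftOp u, Subalgebra.le_topologicalClosure _ (Algebra.subset_adjoin (Or.inr ⟨u, rfl⟩))⟩

/-- Convolution with `exp (-t)`, the resolvent at `1` of the generator of the shifts. It regularises
the shifts, which are not norm continuous in the shift parameter. -/
noncomputable def resolventElt : ConvAlgebra := convElt (integrableKernel_temperedKernel one_pos)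

theorem toOp_convElt (h : IntegrableKernel a) : (convElt h).toOp = convOp h := rfl

theorem toOp_shiftElt (u : ℝ) : (shiftElt u).toOp = shiftOp u := rfl

theorem norm_shiftElt_le (u : ℝ) : ‖shiftElt u‖ ≤ 1 := norm_shiftOp_le u

theorem shiftElt_add {u v : ℝ} (hu : 0 ≤ u) (hv : 0 ≤ v) :
    shiftElt (u + v) = shiftElt u * shiftElt v :=
  ConvAlgebra.toOp_injective (shiftOp_add hu hv)

theorem convElt_temperedKernel_mul {β γ δ : ℝ} (hβ : 0 < β) (hγ : 0 < γ) (hδ : 0 < δ)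
    (h : β + γ = δ) :
    convElt (integrableKernel_temperedKernel hβ) * convElt (integrableKernel_temperedKernel hγ) =
      convElt (integrableKernel_temperedKernel hδ) := by
  subst h
  exact ConvAlgebra.toOp_injective (convOp_temperedKernel_mul hβ hγ)

theorem resolventElt_apply_eq_integral (f : DecaySpace) (t : ℝ) :
    resolventElt.toOp f t = ∫ s in (0 : ℝ)..t, (f s - resolventElt.toOp f s) := by
  set g := resolventElt.toOp f with hg
  rcases lt_or_ge t 0 with ht | ht
  · rw [g.apply_of_nonpos ht.le, intervalIntegral.integral_symm,
      intervalIntegral.integral_zero_ae, neg_zero]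
    refine Eventually.of_forall fun s hs => ?_
    rw [uIoc_of_le ht.le] at hs
    rw [f.apply_of_nonpos hs.2, g.apply_of_nonpos hs.2, sub_zero]
  · have h_heav := causalContinuous_heaviside.causalIntegrable
    have h_exp := causalIntegrable_temperedKernel one_pos
    have h_resolvent : (g : ℝ → ℂ) + heaviside ⋆ g = heaviside ⋆ f := by
      rw [hg, resolventElt, toOp_convElt, coe_convOp_apply,
        ← h_heav.convolution_assoc h_exp f.causalContinuous,
        ← (h_exp.convolutionExists f.causalContinuous).add_distrib
          ((h_heav.convolution h_exp).convolutionExists f.causalContinuous)]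
      exact convolution_congr _ temperedKernel_one_add_heaviside_convolution EventuallyEq.rfl
    have h_causal := f.causalContinuous.sub g.causalContinuous
    change g t = ∫ s in (0 : ℝ)..t, (⇑f - ⇑g) s
    rw [← heaviside_convolution h_causal.causal ht,
      h_heav.convolution_sub f.causalContinuous g.causalContinuous, Pi.sub_apply, ← h_resolvent,
      Pi.add_apply, add_sub_cancel_right]

theorem norm_resolventElt_apply_sub_le (f : DecaySpace) (t t' : ℝ) :
    ‖resolventElt.toOp f t - resolventElt.toOp f t'‖ ≤
      (1 + ‖resolventElt‖) * ‖f‖ * |t - t'| := by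
  have hc : Continuous fun s => f s - resolventElt.toOp f s :=
    f.continuous.sub (resolventElt.toOp f).continuous
  rw [resolventElt_apply_eq_integral f t, resolventElt_apply_eq_integral f t',
    intervalIntegral.integral_interval_sub_left (hc.intervalIntegrable _ _)
      (hc.intervalIntegrable _ _)]
  refine intervalIntegral.norm_integral_le_of_norm_le_const fun s _ => ?_
  calc ‖f s - resolventElt.toOp f s‖ ≤ ‖f s‖ + ‖resolventElt.toOp f s‖ := norm_sub_le _ _
    _ ≤ ‖f‖ + ‖resolventElt‖ * ‖f‖ := add_le_add (f.norm_apply_le s)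
        (((resolventElt.toOp f).norm_apply_le s).trans (resolventElt.toOp.le_opNorm f))
    _ = (1 + ‖resolventElt‖) * ‖f‖ := by ring

theorem continuous_shiftElt_mul_resolventElt :
    Continuous fun u => shiftElt u * resolventElt := by
  refine (LipschitzWith.of_dist_le_mul (K := 1 + ‖resolventElt‖₊) fun u v => ?_).continuous
  rw [dist_eq_norm]
  change ‖(shiftElt u * resolventElt).toOp - (shiftElt v * resolventElt).toOp‖ ≤
    (1 + ‖resolventElt‖) * dist u v
  refine opNorm_le_bound _ (by positivity) fun f =>
    DecaySpace.norm_le (by positivity) fun t => ?_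
  have h_dist : |t - |u| - (t - |v|)| ≤ dist u v := by
    rw [sub_sub_sub_cancel_left, dist_comm, Real.dist_eq]
    exact abs_abs_sub_abs_le_abs_sub v u
  calc ‖resolventElt.toOp f (t - |u|) - resolventElt.toOp f (t - |v|)‖
      ≤ (1 + ‖resolventElt‖) * ‖f‖ * |t - |u| - (t - |v|)| :=
        norm_resolventElt_apply_sub_le f _ _
    _ ≤ (1 + ‖resolventElt‖) * ‖f‖ * dist u v := by gcongr
    _ = (1 + ‖resolventElt‖) * dist u v * ‖f‖ := by ring

theorem integrable_smul_shiftElt_mul_resolventElt (h : Integrable a) :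
    Integrable fun u => (a u : ℂ) • (shiftElt u * resolventElt) := by
  refine (Integrable.ofReal (𝕜 := ℂ) h).smul_bdd ‖resolventElt‖
    continuous_shiftElt_mul_resolventElt.aestronglyMeasurable (Eventually.of_forall fun u => ?_)
  exact (norm_mul_le _ _).trans (mul_le_of_le_one_left (norm_nonneg _) (norm_shiftElt_le u))

theorem convElt_mul_resolventElt (h : IntegrableKernel a) :
    convElt h * resolventElt = ∫ u, (a u : ℂ) • (shiftElt u * resolventElt) := by
  refine ConvAlgebra.toOp_injective
    (ContinuousLinearMap.ext fun f => DFunLike.ext _ _ fun t => ?_)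
  let evalAt : ConvAlgebra →L[ℂ] ℂ :=
    (DecaySpace.evalCLM t ∘L ContinuousLinearMap.apply ℂ DecaySpace f) ∘L ConvAlgebra.toOp
  change (a ⋆ resolventElt.toOp f) t = evalAt _
  rw [← evalAt.integral_comp_comm (integrable_smul_shiftElt_mul_resolventElt h.integrable)]
  refine integral_congr_ae (Eventually.of_forall fun u => ?_)
  simp only [map_smul]
  change a u • resolventElt.toOp f (t - u) = (a u : ℂ) • resolventElt.toOp f (t - |u|)
  rcases lt_or_ge u 0 with hu | hu
  · rw [h.causal u hu, Complex.ofReal_zero, zero_smul, zero_smul]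
  · rw [abs_of_nonneg hu, Complex.coe_smul]

end Algebra

section Characters

variable {χ : WeakDual.characterSpace ℂ ConvAlgebra}

theorem character_temperedKernel_eq_zero (hχ : χ resolventElt = 0) {β : ℝ} (hβ : 0 < β) :
    χ (convElt (integrableKernel_temperedKernel hβ)) = 0 := by
  have of_one_lt {β : ℝ} (h1 : 1 < β) (hβ : 0 < β) :
      χ (convElt (integrableKernel_temperedKernel hβ)) = 0 := by
    rw [← convElt_temperedKernel_mul (sub_pos.2 h1) one_pos hβ (sub_add_cancel β 1), map_mul]
    exact mul_eq_zero_of_right _ hχ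
  have of_one_lt_two_pow_mul (n : ℕ) : ∀ {β : ℝ} (hβ : 0 < β), 1 < 2 ^ n * β →
      χ (convElt (integrableKernel_temperedKernel hβ)) = 0 := by
    induction n with
    | zero => exact fun hβ h => of_one_lt (by simpa using h) hβ
    | succ n ih =>
      intro β hβ h
      have h_double := ih (add_pos hβ hβ) (by rw [pow_succ] at h; linarith)
      rwa [← convElt_temperedKernel_mul hβ hβ (add_pos hβ hβ) rfl, map_mul,
        mul_self_eq_zero] at h_double
  obtain ⟨n, hn⟩ := pow_unbounded_of_one_lt β⁻¹ one_lt_two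
  exact of_one_lt_two_pow_mul n hβ ((inv_lt_iff_one_lt_mul₀ hβ).1 hn)

theorem character_convElt (hχ : χ resolventElt ≠ 0) {a : ℝ → ℝ} (h : IntegrableKernel a) :
    χ (convElt h) = ∫ u, (a u : ℂ) * χ (shiftElt u) := by
  refine mul_right_cancel₀ hχ ?_
  rw [← map_mul, convElt_mul_resolventElt, ← integral_mul_const]
  refine ((WeakDual.CharacterSpace.toCLM χ).integral_comp_comm
    (integrable_smul_shiftElt_mul_resolventElt h.integrable)).symm.trans ?_
  refine integral_congr_ae (Eventually.of_forall fun u => ?_)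
  change χ ((a u : ℂ) • (shiftElt u * resolventElt)) = _
  simp only [map_smul, map_mul, smul_eq_mul, mul_assoc]

theorem continuous_character_shiftElt (hχ : χ resolventElt ≠ 0) :
    Continuous fun u => χ (shiftElt u) := by
  have h_cont : Continuous fun u => χ (shiftElt u * resolventElt) / χ resolventElt :=
    ((map_continuous χ).comp continuous_shiftElt_mul_resolventElt).div_const _
  simpa only [map_mul, mul_div_cancel_right₀ _ hχ] using h_cont

theorem exists_character_shiftElt_eq_exp (hχ : χ resolventElt ≠ 0) :
    ∃ s : ℂ, 0 ≤ s.re ∧ ∀ u : ℝ, 0 ≤ u → χ (shiftElt u) = Complex.exp (-(s * u)) := by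
  have h_mul (u v : ℝ) (hu : 0 ≤ u) (hv : 0 ≤ v) :
      χ (shiftElt (u + v)) = χ (shiftElt u) * χ (shiftElt v) := by
    rw [shiftElt_add hu hv, map_mul]
  have h_bound (u : ℝ) : ‖χ (shiftElt u)‖ ≤ ‖WeakDual.CharacterSpace.toCLM χ‖ * 1 :=
    (WeakDual.CharacterSpace.toCLM χ).le_opNorm_of_le (norm_shiftElt_le u)
  refine exists_eq_exp_of_mul (continuous_character_shiftElt hχ) h_mul h_bound ?_
  convert hχ using 1
  rw [resolventElt, character_convElt hχ, ← integral_indicator measurableSet_Ioi]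
  refine integral_congr_ae (Eventually.of_forall fun u => ?_)
  rcases le_or_gt u 0 with hu | hu
  · simp [hu, temperedKernel_of_nonpos]
  · simp [hu, temperedKernel_one_of_pos]

theorem character_eq_zero_or_eq_laplaceTransform (χ : WeakDual.characterSpace ℂ ConvAlgebra) :
    (∀ (β : ℝ) (hβ : 0 < β), χ (convElt (integrableKernel_temperedKernel hβ)) = 0) ∨
      ∃ s : ℂ, 0 ≤ s.re ∧ (∀ u : ℝ, 0 ≤ u → χ (shiftElt u) = Complex.exp (-(s * u))) ∧
        ∀ (a : ℝ → ℝ) (h : IntegrableKernel a), χ (convElt h) = laplaceTransform a s := by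
  by_cases hχ : χ resolventElt = 0
  · exact .inl fun _ => character_temperedKernel_eq_zero hχ
  obtain ⟨s, hs, h_shift⟩ := exists_character_shiftElt_eq_exp hχ
  refine .inr ⟨s, hs, h_shift, fun a h => ?_⟩
  rw [character_convElt hχ]
  refine integral_congr_ae (Eventually.of_forall fun u => ?_)
  rcases lt_or_ge u 0 with hu | hu
  · simp [h.causal u hu]
  · simp [h_shift u hu]

end Characters

/-! ### The linear delay equation -/

section MatrixAction

variable {ι : Type*} [Fintype ι] (B C : Matrix ι ι ConvAlgebra) (z : ι → DecaySpace)

/-- The action of matrices over the convolution algebra on vectors of functions. -/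
noncomputable def matrixAction : (ι → DecaySpace) →L[ℂ] (ι → DecaySpace) :=
  ContinuousLinearMap.pi fun i => ∑ j, (B i j).toOp ∘L ContinuousLinearMap.proj j

theorem matrixAction_apply (i : ι) : matrixAction B z i = ∑ j, (B i j).toOp (z j) := by
  simp [matrixAction]

theorem matrixAction_one [DecidableEq ι] :
    matrixAction (1 : Matrix ι ι ConvAlgebra) z = z := by
  ext1 i
  rw [matrixAction_apply, Finset.sum_eq_single_of_mem i (Finset.mem_univ i) fun j _ hj => by
    simp [Matrix.one_apply_ne hj.symm], Matrix.one_apply_eq, ConvAlgebra.toOp_one]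
  rfl

theorem matrixAction_mul : matrixAction (B * C) z = matrixAction B (matrixAction C z) := by
  ext1 i
  simp only [matrixAction_apply, Matrix.mul_apply, map_sum, ConvAlgebra.toOp_mul, sum_apply,
    ContinuousLinearMap.mul_def, ContinuousLinearMap.comp_apply]
  exact Finset.sum_comm

theorem matrixAction_add : matrixAction (B + C) z = matrixAction B z + matrixAction C z := by
  ext1 i
  simp [matrixAction_apply, Finset.sum_add_distrib]

theorem matrixAction_sub : matrixAction (B - C) z = matrixAction B z - matrixAction C z := by
  ext1 i
  simp [matrixAction_apply, Finset.sum_sub_distrib]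

theorem matrixAction_smul_apply (c : ConvAlgebra) (i : ι) :
    matrixAction (c • B) z i = c.toOp (matrixAction B z i) := by
  simp [matrixAction_apply, ConvAlgebra.toOp_mul, ContinuousLinearMap.mul_def]

theorem matrixAction_map_algebraMap_apply (A : Matrix ι ι ℂ) (i : ι) :
    matrixAction (A.map (algebraMap ℂ ConvAlgebra)) z i = ∑ j, A i j • z j := by
  simp [matrixAction_apply, Algebra.algebraMap_eq_smul_one, ConvAlgebra.toOp_one]

end MatrixAction

section DelayMatrix

variable {ι : Type*} [Fintype ι] [DecidableEq ι] {α τ : ℝ}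

/-- The matrix `1 - Q (N + A S_τ)` over the convolution algebra, with `Q` and `N` the convolutions
with the tempered kernel and the correction kernel of order `α`. -/
noncomputable def delayMatrix (hα0 : 0 < α) (hα1 : α < 1) (τ : ℝ) (A : Matrix ι ι ℂ) :
    Matrix ι ι ConvAlgebra :=
  1 - convElt (integrableKernel_temperedKernel hα0) •
    (convElt (integrableKernel_correctionKernel hα0 hα1) • (1 : Matrix ι ι ConvAlgebra) +
      shiftElt τ • A.map (algebraMap ℂ ConvAlgebra))

theorem map_delayMatrix (hα0 : 0 < α) (hα1 : α < 1) (τ : ℝ) (A : Matrix ι ι ℂ)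
    (f : ConvAlgebra →ₐ[ℂ] ℂ) :
    f.mapMatrix (delayMatrix hα0 hα1 τ A) =
      1 - f (convElt (integrableKernel_temperedKernel hα0)) •
        (f (convElt (integrableKernel_correctionKernel hα0 hα1)) • (1 : Matrix ι ι ℂ) +
          f (shiftElt τ) • A) := by
  ext i j
  simp [delayMatrix, Matrix.one_apply, apply_ite f]

theorem delaySymbol_eq_smul {s : ℂ} (hs : 0 ≤ s.re) (α τ : ℂ) (A : Matrix ι ι ℂ) :
    1 - (1 + s) ^ (-α) •
        (((1 + s) ^ α - s ^ α) • (1 : Matrix ι ι ℂ) + Complex.exp (-(s * τ)) • A) =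
      ((1 + s) ^ (-α) * Complex.exp (-(s * τ))) •
        (algebraMap ℂ (Matrix ι ι ℂ) (s ^ α * Complex.exp (s * τ)) - A) := by
  have h_cpow : (1 + s) ^ (-α) * (1 + s) ^ α = 1 := by
    rw [← Complex.cpow_add _ _ (one_add_ne_zero_of_re_nonneg hs), neg_add_cancel, Complex.cpow_zero]
  have h_exp : Complex.exp (-(s * τ)) * Complex.exp (s * τ) = 1 := by
    rw [← Complex.exp_add, neg_add_cancel, Complex.exp_zero]
  rw [Algebra.algebraMap_eq_smul_one]
  match_scalars
  · linear_combination -h_cpow - (1 + s) ^ (-α) * s ^ α * h_exp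
  · ring

theorem isUnit_delayMatrix (hα0 : 0 < α) (hα1 : α < 1) (hτ : 0 < τ) {A : Matrix ι ι ℂ}
    (hA : spectrum ℂ A ⊆ stabilityRegion α τ) : IsUnit (delayMatrix hα0 hα1 τ A) := by
  rw [Matrix.isUnit_iff_isUnit_det]
  by_contra h_det
  obtain ⟨χ, hχ⟩ := WeakDual.CharacterSpace.exists_apply_eq_zero h_det
  let f := WeakDual.CharacterSpace.toAlgHom χ
  have h_symbol : ¬ IsUnit (f.mapMatrix (delayMatrix hα0 hα1 τ A)) := by
    rw [Matrix.isUnit_iff_isUnit_det, ← AlgHom.map_det]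
    exact fun h => h.ne_zero hχ
  refine h_symbol ?_
  rw [map_delayMatrix]
  rcases character_eq_zero_or_eq_laplaceTransform χ with h_zero | ⟨s, hs, h_shift, h_conv⟩
  · rw [show f (convElt (integrableKernel_temperedKernel hα0)) = 0 from h_zero α hα0, zero_smul,
      sub_zero]
    exact isUnit_one
  · rw [show f (shiftElt τ) = _ from h_shift τ hτ.le,
      show f (convElt (integrableKernel_temperedKernel hα0)) = _ from h_conv _ _,
      show f (convElt (integrableKernel_correctionKernel hα0 hα1)) = _ from h_conv _ _,
      laplaceTransform_temperedKernel hα0 hs, laplaceTransform_correctionKernel hα0 hα1 hs,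
      delaySymbol_eq_smul hs]
    have h_resolvent := spectrum.notMem_iff.1 fun h =>
      cpow_mul_exp_notMem_stabilityRegion hα0 hτ hs (hA h)
    have h_ne : (1 + s) ^ (-(α : ℂ)) * Complex.exp (-(s * τ)) ≠ 0 :=
      mul_ne_zero (Complex.cpow_ne_zero_iff.2 (.inl (one_add_ne_zero_of_re_nonneg hs)))
        (Complex.exp_ne_zero _)
    exact h_resolvent.smul (Units.mk0 _ h_ne)

theorem matrixAction_delayMatrix_apply (hα0 : 0 < α) (hα1 : α < 1) (τ : ℝ) (A : Matrix ι ι ℂ)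
    (z : ι → DecaySpace) (i : ι) :
    matrixAction (delayMatrix hα0 hα1 τ A) z i =
      z i - convOp (integrableKernel_temperedKernel hα0)
        (convOp (integrableKernel_correctionKernel hα0 hα1) (z i) +
          ∑ j, A i j • shiftOp τ (z j)) := by
  simp only [delayMatrix, matrixAction_sub, matrixAction_one, Pi.sub_apply, Pi.add_apply,
    matrixAction_smul_apply, matrixAction_add, matrixAction_map_algebraMap_apply, toOp_convElt,
    toOp_shiftElt, map_sum, map_smul]

theorem exists_linear_solver (hα0 : 0 < α) (hα1 : α < 1) (hτ : 0 < τ) {A : Matrix ι ι ℂ}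
    (hA : spectrum ℂ A ⊆ stabilityRegion α τ) :
    ∃ G : (ι → DecaySpace) →L[ℂ] (ι → DecaySpace), ∀ (h : ι → ℝ → ℂ) (b : ι → DecaySpace),
      (∀ i, CausalContinuous (h i)) → (∀ i, ⇑(b i) = temperedKernel α ⋆ h i) → ∀ i,
        rlKernel (1 - α) ⋆ ⇑(G b i) =
          heaviside ⋆ fun t => ∑ j, A i j * G b j (t - τ) + h i t := by
  obtain ⟨⟨M, B, h_mul, -⟩, rfl : M = delayMatrix hα0 hα1 τ A⟩ := isUnit_delayMatrix hα0 hα1 hτ hA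
  refine ⟨matrixAction B, fun h b hh hb i => ?_⟩
  set z := matrixAction B b
  have h_action : matrixAction (delayMatrix hα0 hα1 τ A) z = b := by
    rw [← matrixAction_mul, h_mul, matrixAction_one]
  set y : DecaySpace := ∑ j, A i j • shiftOp τ (z j)
  have hy : ⇑y + h i = fun t => ∑ j, A i j * z j (t - τ) + h i t := by
    funext t
    have h_eval := map_sum (DecaySpace.evalCLM t) (fun j => A i j • shiftOp τ (z j)) Finset.univ
    simp only [map_smul] at h_eval
    refine congrArg (· + h i t) (h_eval.trans (Finset.sum_congr rfl fun j _ => ?_))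
    exact congrArg (fun u => A i j * z j (t - u)) (abs_of_pos hτ)
  have hv : CausalContinuous (⇑y + h i) := y.causalContinuous.add (hh i)
  have hn := CausalContinuous.convolution (causalIntegrable_correctionKernel hα0 hα1)
    (z i).causalContinuous
  have hq := causalIntegrable_temperedKernel hα0
  have h_fix : ⇑(z i) = temperedKernel α ⋆ (correctionKernel α ⋆ ⇑(z i) + (⇑y + h i)) := by
    have := matrixAction_delayMatrix_apply hα0 hα1 τ A z i
    rw [h_action, eq_sub_iff_add_eq] at this
    rw [← add_assoc, (hq.convolutionExists (hn.add y.causalContinuous)).distrib_add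
      (hq.convolutionExists (hh i)), ← hb]
    exact ((congrArg DFunLike.coe this).symm).trans (add_comm _ _)
  have h_int := rlKernel_convolution_temperedKernel_convolution hα0 hα1 (hn.add hv)
  have hH := causalContinuous_heaviside.causalIntegrable
  rw [← h_fix, (hH.convolutionExists hn).distrib_add (hH.convolutionExists hv), add_comm,
    add_right_inj] at h_int
  rw [h_int, hy]

end DelayMatrix

section CausalExp

/-- The function `exp (-t)` cut off to `[0, ∞)`. It differs from `temperedKernel 1` by its value at
the origin, which makes it continuous from the right there. -/
noncomputable def causalExp : ℝ → ℝ := (Ici 0).indicator fun t => Real.exp (-t)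

theorem causalExp_of_nonneg {t : ℝ} (ht : 0 ≤ t) : causalExp t = Real.exp (-t) :=
  indicator_of_mem (mem_Ici.2 ht) _

theorem causalContinuous_causalExp : CausalContinuous causalExp := .indicator_Ici (by fun_prop)

theorem integrable_causalExp : Integrable causalExp := by
  refine (integrable_temperedKernel one_pos).congr ?_
  filter_upwards [Measure.ae_ne volume 0] with t ht
  rcases lt_or_gt_of_ne ht with ht | ht
  · rw [causal_temperedKernel 1 t ht, causalContinuous_causalExp.causal t ht]
  · rw [temperedKernel_one_of_pos ht, causalExp_of_nonneg ht.le]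

theorem tendsto_causalExp : Tendsto causalExp atTop (𝓝 0) :=
  Real.tendsto_exp_neg_atTop_nhds_zero.congr' <| by
    filter_upwards [eventually_ge_atTop 0] with t ht using (causalExp_of_nonneg ht).symm

theorem heaviside_convolution_causalExp : heaviside ⋆ causalExp = heaviside - causalExp := by
  funext t
  rcases lt_or_ge t 0 with ht | ht
  · simp [causalContinuous_heaviside.causal.convolution causalContinuous_causalExp.causal t ht,
      causalContinuous_causalExp.causal t ht, ht]
  · rw [heaviside_convolution causalContinuous_causalExp.causal ht,
      intervalIntegral.integral_congr (g := fun s => Real.exp (-s)) fun s hs =>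
        causalExp_of_nonneg (uIcc_of_le ht ▸ hs).1,
      intervalIntegral.integral_comp_neg, integral_exp]
    simp [causalExp_of_nonneg ht, ht]

theorem norm_rlKernel_indicator_Ioi_le {β : ℝ} (hβ0 : 0 < β) (hβ1 : β ≤ 1) (t : ℝ) :
    ‖(Ioi 1).indicator (rlKernel β) t‖ ≤ (Real.Gamma β)⁻¹ := by
  have h_gamma := Real.Gamma_pos_of_pos hβ0
  rcases le_or_gt t 1 with ht | ht
  · simpa [ht] using h_gamma.le
  · rw [indicator_of_mem (mem_Ioi.2 ht), Real.norm_of_nonneg (rlKernel_nonneg hβ0 t),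
      rlKernel_of_pos (one_pos.trans ht), inv_eq_one_div]
    gcongr
    exact Real.rpow_le_one_of_one_le_of_nonpos ht.le (sub_nonpos.2 hβ1)

theorem tendsto_rlKernel_atTop {β : ℝ} (hβ : β < 1) : Tendsto (rlKernel β) atTop (𝓝 0) := by
  have h := (tendsto_rpow_neg_atTop (sub_pos.2 hβ)).div_const (Real.Gamma β)
  rw [zero_div] at h
  refine h.congr' ?_
  filter_upwards [eventually_gt_atTop 0] with t ht
  rw [rlKernel_of_pos ht, neg_sub]

/-- The kernel is the sum of an integrable part, near the origin, and a part tending to zero. -/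
theorem tendsto_rlKernel_convolution_causalExp {β : ℝ} (hβ0 : 0 < β) (hβ1 : β < 1) :
    Tendsto (rlKernel β ⋆ causalExp) atTop (𝓝 0) := by
  have hk := causalIntegrable_rlKernel hβ0
  have he := causalContinuous_causalExp
  set near := (Iic 1).indicator (rlKernel β)
  set far := (Ioi 1).indicator (rlKernel β)
  obtain ⟨C, hC⟩ := he.exists_norm_le_of_tendsto tendsto_causalExp
  have h_near : Tendsto (near ⋆ causalExp) atTop (𝓝 0) :=
    tendsto_convolution_atTop (hk.integrable_indicator_Iic 1)
      integrable_causalExp.aestronglyMeasurable hC tendsto_causalExp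
  have h_far : Tendsto (causalExp ⋆ far) atTop (𝓝 0) := by
    refine tendsto_convolution_atTop integrable_causalExp
      ((measurable_rlKernel β).indicator measurableSet_Ioi).aestronglyMeasurable
      (norm_rlKernel_indicator_Ioi_le hβ0 hβ1.le) ?_
    refine (tendsto_rlKernel_atTop hβ1).congr' ?_
    filter_upwards [eventually_gt_atTop 1] with t ht using (indicator_of_mem (mem_Ioi.2 ht) _).symm
  have h_sum : rlKernel β ⋆ causalExp = near ⋆ causalExp + causalExp ⋆ far := by
    rw [convolution_mul_comm causalExp, ← ((hk.indicator measurableSet_Iic).convolutionExists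
      he).add_distrib ((hk.indicator measurableSet_Ioi).convolutionExists he), ← compl_Iic,
      indicator_self_add_compl]
  rw [h_sum, ← add_zero (0 : ℝ)]
  exact h_near.add h_far

theorem rlKernel_convolution_heaviside_sub_causalExp {β : ℝ} (hβ : 0 < β) :
    rlKernel β ⋆ (heaviside - causalExp) = heaviside ⋆ (rlKernel β ⋆ causalExp) := by
  rw [← heaviside_convolution_causalExp, (causalIntegrable_rlKernel hβ).convolution_left_comm
    causalContinuous_heaviside.causalIntegrable causalContinuous_causalExp]

end CausalExp

section RealPart

variable {ι : Type*}

/-- The real part of a vector of elements of `DecaySpace`, as a vector-valued function. -/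
noncomputable def realPart (z : ι → DecaySpace) (t : ℝ) (i : ι) : ℝ := (z i t).re

theorem continuous_realPart (z : ι → DecaySpace) : Continuous (realPart z) :=
  continuous_pi fun i => Complex.continuous_re.comp (z i).continuous

theorem realPart_of_nonpos (z : ι → DecaySpace) {t : ℝ} (ht : t ≤ 0) : realPart z t = 0 := by
  ext1 i
  simp [realPart, (z i).apply_of_nonpos ht]

theorem tendsto_realPart (z : ι → DecaySpace) : Tendsto (realPart z) atTop (𝓝 0) :=
  tendsto_pi_nhds.2 fun i => (Complex.continuous_re.tendsto 0).comp (z i).tendsto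

variable [Fintype ι]

theorem causalContinuous_realPart (z : ι → DecaySpace) : CausalContinuous (realPart z) :=
  .of_continuous (continuous_realPart z) fun _ ht => realPart_of_nonpos z ht.le

theorem causalContinuous_mulVec_realPart {τ : ℝ} (hτ : 0 ≤ τ) (A : Matrix ι ι ℝ)
    (z : ι → DecaySpace) : CausalContinuous fun t => A.mulVec (realPart z (t - τ)) := by
  have := continuous_realPart z
  refine .of_continuous (by fun_prop) fun t ht => ?_
  rw [realPart_of_nonpos z (by linarith), Matrix.mulVec_zero]

theorem norm_realPart_le (z : ι → DecaySpace) (t : ℝ) : ‖realPart z t‖ ≤ ‖z‖ :=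
  (pi_norm_le_iff_of_nonneg (norm_nonneg z)).2 fun i =>
    ((Complex.abs_re_le_norm _).trans ((z i).norm_apply_le t)).trans (norm_le_pi_norm z i)

theorem norm_realPart_sub_le (z z' : ι → DecaySpace) (t : ℝ) :
    ‖realPart z t - realPart z' t‖ ≤ ‖z - z'‖ := by
  convert norm_realPart_le (z - z') t using 2
  ext1 i
  exact (Complex.sub_re _ _).symm

end RealPart

section Smoothing

variable {ι : Type*} {a : ℝ → ℝ} {v w : ℝ → ι → ℝ}

/-- The coordinates of `ℝ^ι` as complex numbers. -/
noncomputable def complexCoord (i : ι) : (ι → ℝ) →L[ℝ] ℂ :=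
  Complex.ofRealCLM ∘L ContinuousLinearMap.proj i

theorem tendsto_complexCoord (i : ι) (hlim : Tendsto w atTop (𝓝 0)) :
    Tendsto (complexCoord i ∘ w) atTop (𝓝 0) :=
  map_zero (complexCoord i) ▸ ((complexCoord i).continuous.tendsto 0).comp hlim

variable [Fintype ι]

theorem norm_complexCoord_le (i : ι) (x : ι → ℝ) : ‖complexCoord i x‖ ≤ ‖x‖ :=
  (Complex.norm_real (x i)).le.trans (norm_le_pi_norm x i)

/-- The componentwise convolution of an integrable kernel with a function that may jump at the
origin. -/
noncomputable def smoothing (h : IntegrableKernel a) (hw : CausalContinuous w)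
    (hlim : Tendsto w atTop (𝓝 0)) : ι → DecaySpace := fun i =>
  .ofFun (a ⋆ (complexCoord i ∘ w))
    (h.causalIntegrable.continuous_convolution (hw.clm_comp _))
    (fun _ ht => h.causal.convolution_of_nonpos (hw.clm_comp _).causal ht)
    (tendsto_convolution_atTop h.integrable (hw.clm_comp _).causalIntegrable.aestronglyMeasurable
      ((hw.clm_comp _).exists_norm_le_of_tendsto (tendsto_complexCoord i hlim)).choose_spec
      (tendsto_complexCoord i hlim))

theorem coe_smoothing (h : IntegrableKernel a) (hw : CausalContinuous w)
    (hlim : Tendsto w atTop (𝓝 0)) (i : ι) :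
    ⇑(smoothing h hw hlim i) = a ⋆ (complexCoord i ∘ w) := rfl

theorem norm_smoothing_le (h : IntegrableKernel a) (hw : CausalContinuous w)
    (hlim : Tendsto w atTop (𝓝 0)) {C : ℝ} (hC0 : 0 ≤ C) (hC : ∀ t, ‖w t‖ ≤ C) :
    ‖smoothing h hw hlim‖ ≤ (∫ u, ‖a u‖) * C := by
  have h_nonneg : 0 ≤ (∫ u, ‖a u‖) * C := mul_nonneg (by positivity) hC0
  exact (pi_norm_le_iff_of_nonneg h_nonneg).2 fun i => DecaySpace.norm_le h_nonneg <|
    norm_convolution_le h.integrable fun t => (norm_complexCoord_le i _).trans (hC t)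

theorem smoothing_sub (h : IntegrableKernel a) (hv : CausalContinuous v)
    (hv_lim : Tendsto v atTop (𝓝 0)) (hw : CausalContinuous w) (hw_lim : Tendsto w atTop (𝓝 0)) :
    smoothing h hv hv_lim - smoothing h hw hw_lim =
      smoothing h (hv.sub hw) (sub_zero (0 : ι → ℝ) ▸ hv_lim.sub hw_lim) := by
  funext i
  refine DFunLike.coe_injective ?_
  rw [coe_smoothing, show complexCoord i ∘ (v - w) = complexCoord i ∘ v - complexCoord i ∘ w by
    ext1 t; exact map_sub _ _ _, h.causalIntegrable.convolution_sub (hv.clm_comp _) (hw.clm_comp _)]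
  rfl

end Smoothing

section LinearEquation

variable {ι : Type*} [Fintype ι] [DecidableEq ι] {α τ : ℝ}

theorem exists_real_linear_solver (hα0 : 0 < α) (hα1 : α < 1) (hτ : 0 < τ) {A : Matrix ι ι ℝ}
    (hA : spectrum ℂ (A.map (fun a : ℝ => (a : ℂ))) ⊆ stabilityRegion α τ) :
    ∃ G : (ι → DecaySpace) →L[ℂ] (ι → DecaySpace),
      ∀ (w : ℝ → ι → ℝ) (hw : CausalContinuous w) (hlim : Tendsto w atTop (𝓝 0)),
        let z := G (smoothing (integrableKernel_temperedKernel hα0) hw hlim)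
        rlKernel (1 - α) ⋆ realPart z =
          heaviside ⋆ fun t => A.mulVec (realPart z (t - τ)) + w t := by
  obtain ⟨G, hG⟩ := exists_linear_solver hα0 hα1 hτ hA
  refine ⟨G, ?_⟩
  intro w hw hlim z
  have hk := causalIntegrable_rlKernel (sub_pos.2 hα1)
  have hH := causalContinuous_heaviside.causalIntegrable
  have h_complex (i : ι) : rlKernel (1 - α) ⋆ ⇑(z i) = heaviside ⋆
      fun t => ∑ j, (A i j : ℂ) * z j (t - τ) + w t i :=
    hG (fun i => complexCoord i ∘ w) _ (fun i => hw.clm_comp _)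
      (fun i => coe_smoothing _ hw hlim i) i
  have h_source : CausalContinuous fun t => A.mulVec (realPart z (t - τ)) + w t :=
    (causalContinuous_mulVec_realPart hτ.le A z).add hw
  have h_source_complex (i : ι) : CausalContinuous
      fun t => ∑ j, (A i j : ℂ) * z j (t - τ) + w t i := by
    refine .add (.of_continuous ?_ fun t ht => ?_) (hw.clm_comp (complexCoord i))
    · have (j : ι) := (z j).continuous
      fun_prop
    · exact Finset.sum_eq_zero fun j _ => by rw [(z j).apply_of_nonpos (by linarith), mul_zero]
  funext t i
  have h_re := congrFun (congrArg (Complex.reCLM ∘ ·) (h_complex i)) t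
  rw [← hk.convolution_clm_comp _ (z i).causalContinuous,
    ← hH.convolution_clm_comp _ (h_source_complex i)] at h_re
  have h_coord := hk.convolution_clm_comp (ContinuousLinearMap.proj (R := ℝ) i)
    (causalContinuous_realPart z)
  have h_coord' := hH.convolution_clm_comp (ContinuousLinearMap.proj (R := ℝ) i) h_source
  refine (congrFun h_coord t).symm.trans (h_re.trans (Eq.trans ?_ (congrFun h_coord' t)))
  congr 2
  funext s
  simp [Matrix.mulVec, dotProduct, realPart]

end LinearEquation

/-! ### Decaying solutions of the nonlinear equation -/

section HistoryExt

variable {E : Type*} [NormedAddCommGroup E] [NormedSpace ℝ E] {τ δ t : ℝ} {φ : ℝ → E}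

/-- The extension of the initial function `φ` to the line which equals `exp (-t) • φ 0` for
`t ≥ 0`; its Caputo derivative is explicit. -/
noncomputable def historyExt (τ : ℝ) (φ : ℝ → E) (t : ℝ) : E :=
  Real.exp (-max t 0) • φ (max (-τ) (min t 0))

theorem continuous_historyExt (hτ : 0 ≤ τ) (hφ : ContinuousOn φ (Icc (-τ) 0)) :
    Continuous (historyExt τ φ) :=
  .smul (by fun_prop) <| hφ.comp_continuous (by fun_prop) fun _ =>
    ⟨le_max_left _ _, max_le (neg_nonpos.2 hτ) (min_le_right _ _)⟩

theorem historyExt_of_mem (ht : t ∈ Icc (-τ) 0) : historyExt τ φ t = φ t := by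
  rw [historyExt, min_eq_left ht.2, max_eq_right ht.2, max_eq_right ht.1, neg_zero, Real.exp_zero,
    one_smul]

theorem historyExt_of_nonneg (hτ : 0 ≤ τ) (ht : 0 ≤ t) :
    historyExt τ φ t = Real.exp (-t) • φ 0 := by
  rw [historyExt, min_eq_right ht, max_eq_left ht, max_eq_right (neg_nonpos.2 hτ)]

theorem norm_historyExt_le (hτ : 0 ≤ τ) (hδ : ∀ s ∈ Icc (-τ) 0, ‖φ s‖ ≤ δ) (t : ℝ) :
    ‖historyExt τ φ t‖ ≤ δ := by
  rw [historyExt, norm_smul, Real.norm_of_nonneg (Real.exp_nonneg _)]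
  exact (mul_le_of_le_one_left (norm_nonneg _) (Real.exp_le_one_iff.2 (by simp))).trans
    (hδ _ ⟨le_max_left _ _, max_le (neg_nonpos.2 hτ) (min_le_right _ _)⟩)

theorem tendsto_historyExt (hτ : 0 ≤ τ) : Tendsto (historyExt τ φ) atTop (𝓝 0) := by
  have h := Real.tendsto_exp_neg_atTop_nhds_zero.smul_const (φ 0)
  rw [zero_smul] at h
  refine h.congr' ?_
  filter_upwards [eventually_ge_atTop 0] with t ht using (historyExt_of_nonneg hτ ht).symm

end HistoryExt

section Trajectory

variable {ι : Type*} {ψ : ℝ → ι → ℝ}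

/-- The function with given part `ψ` and unknown decaying part `z`. -/
noncomputable def trajectory (ψ : ℝ → ι → ℝ) (z : ι → DecaySpace) : ℝ → ι → ℝ := ψ + realPart z

theorem continuous_trajectory (hψ : Continuous ψ) (z : ι → DecaySpace) :
    Continuous (trajectory ψ z) :=
  hψ.add (continuous_realPart z)

theorem tendsto_trajectory (hψ : Tendsto ψ atTop (𝓝 0)) (z : ι → DecaySpace) :
    Tendsto (trajectory ψ z) atTop (𝓝 0) :=
  add_zero (0 : ι → ℝ) ▸ hψ.add (tendsto_realPart z)

theorem trajectory_of_nonpos (ψ : ℝ → ι → ℝ) (z : ι → DecaySpace) {t : ℝ} (ht : t ≤ 0) :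
    trajectory ψ z t = ψ t := by
  rw [trajectory, Pi.add_apply, realPart_of_nonpos z ht, add_zero]

variable [Fintype ι]

theorem norm_trajectory_le (ψ : ℝ → ι → ℝ) (z : ι → DecaySpace) (t : ℝ) :
    ‖trajectory ψ z t‖ ≤ ‖ψ t‖ + ‖z‖ :=
  norm_add_le_of_le le_rfl (norm_realPart_le z t)

theorem norm_trajectory_sub_le (ψ : ℝ → ι → ℝ) (z z' : ι → DecaySpace) (t : ℝ) :
    ‖trajectory ψ z t - trajectory ψ z' t‖ ≤ ‖z - z'‖ := by
  simpa only [trajectory, Pi.add_apply, add_sub_add_left_eq_sub] using norm_realPart_sub_le z z' t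

end Trajectory

section Forcing

variable {ι : Type*} [Fintype ι] {α τ δ : ℝ} {A : Matrix ι ι ℝ}
  {g : (ι → ℝ) → (ι → ℝ) → ι → ℝ} {φ : ℝ → ι → ℝ}

/-- The source term of the linear equation for the decaying part `z` of a solution. It collects the
nonlinearity and the terms coming from `historyExt τ φ`. -/
noncomputable def forcing (α τ : ℝ) (A : Matrix ι ι ℝ) (g : (ι → ℝ) → (ι → ℝ) → ι → ℝ)
    (φ : ℝ → ι → ℝ) (z : ι → DecaySpace) : ℝ → ι → ℝ :=
  (Ici 0).indicator fun t => A.mulVec (historyExt τ φ (t - τ)) +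
    g (trajectory (historyExt τ φ) z t) (trajectory (historyExt τ φ) z (t - τ)) +
    (rlKernel (1 - α) ⋆ causalExp) t • φ 0

theorem causalContinuous_forcing (hα1 : α < 1) (hτ : 0 ≤ τ) (hg : Continuous (Function.uncurry g))
    (hφ : ContinuousOn φ (Icc (-τ) 0)) (z : ι → DecaySpace) :
    CausalContinuous (forcing α τ A g φ z) := by
  have hψ := continuous_historyExt hτ hφ
  have hx := continuous_trajectory hψ z
  have h_shift : Continuous fun t : ℝ => t - τ := by fun_prop
  have h_exp : Continuous (rlKernel (1 - α) ⋆ causalExp) :=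
    (causalIntegrable_rlKernel (sub_pos.2 hα1)).continuous_convolution causalContinuous_causalExp
  exact .indicator_Ici <| ((continuous_const.matrix_mulVec (hψ.comp h_shift)).add
    (hg.comp (hx.prodMk (hx.comp h_shift)))).add (h_exp.smul continuous_const)

theorem tendsto_forcing (hα0 : 0 < α) (hα1 : α < 1) (hτ : 0 ≤ τ)
    (hg : Continuous (Function.uncurry g)) (hg0 : g 0 0 = 0) (z : ι → DecaySpace) :
    Tendsto (forcing α τ A g φ z) atTop (𝓝 0) := by
  have hψ := tendsto_historyExt hτ (φ := φ)
  have hx := tendsto_trajectory hψ z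
  have h_shift : Tendsto (fun t : ℝ => t - τ) atTop atTop :=
    tendsto_atTop_add_const_right _ _ tendsto_id
  have h_linear : Tendsto (fun t => A.mulVec (historyExt τ φ (t - τ))) atTop (𝓝 0) :=
    A.mulVec_zero ▸ (A.mulVecLin.continuous_of_finiteDimensional.tendsto 0).comp
      (hψ.comp h_shift)
  have h_nonlinear : Tendsto (fun t => g (trajectory (historyExt τ φ) z t)
      (trajectory (historyExt τ φ) z (t - τ))) atTop (𝓝 0) :=
    hg0 ▸ (hg.tendsto ((0 : ι → ℝ), (0 : ι → ℝ))).comp (hx.prodMk_nhds (hx.comp h_shift))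
  have h_exp := (tendsto_rlKernel_convolution_causalExp (sub_pos.2 hα1)
    (sub_lt_self 1 hα0)).smul_const (φ 0)
  have h_sum := (h_linear.add h_nonlinear).add h_exp
  rw [zero_smul, add_zero, add_zero] at h_sum
  refine h_sum.congr' ?_
  filter_upwards [eventually_ge_atTop 0] with t ht
  rw [forcing, indicator_of_mem (mem_Ici.2 ht)]

variable {K : NNReal}

theorem norm_forcing_sub_le (hg : LipschitzWith K (Function.uncurry g)) (z z' : ι → DecaySpace)
    (t : ℝ) : ‖(forcing α τ A g φ z - forcing α τ A g φ z') t‖ ≤ K * ‖z - z'‖ := by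
  rw [forcing, forcing, ← indicator_sub']
  refine (norm_indicator_le_norm_self _ t).trans ?_
  rw [Pi.sub_apply, add_sub_add_right_eq_sub, add_sub_add_left_eq_sub]
  refine (hg.norm_sub_le (_, _) (_, _)).trans (mul_le_mul_of_nonneg_left ?_ K.coe_nonneg)
  exact max_le (norm_trajectory_sub_le _ _ _ _) (norm_trajectory_sub_le _ _ _ _)

theorem norm_forcing_zero_le (hτ : 0 ≤ τ)
    (hg : LipschitzWith K (Function.uncurry g)) (hg0 : g 0 0 = 0) {Z : ℝ}
    (hZ : ∀ t, ‖(rlKernel (1 - α) ⋆ causalExp) t‖ ≤ Z)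
    (hδ : ∀ s ∈ Icc (-τ) 0, ‖φ s‖ ≤ δ) (t : ℝ) :
    ‖forcing α τ A g φ 0 t‖ ≤ (‖A.mulVecLin.toContinuousLinearMap‖ + K + Z) * δ := by
  have hψ := norm_historyExt_le hτ hδ
  have hx (t : ℝ) : ‖trajectory (historyExt τ φ) 0 t‖ ≤ δ := by
    simpa using (norm_trajectory_le _ 0 t).trans (add_le_add_left (hψ t) ‖(0 : ι → DecaySpace)‖)
  have h_linear : ‖A.mulVec (historyExt τ φ (t - τ))‖ ≤ ‖A.mulVecLin.toContinuousLinearMap‖ * δ :=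
    A.mulVecLin.toContinuousLinearMap.le_opNorm_of_le (hψ _)
  have h_nonlinear (x y : ι → ℝ) (hx : ‖x‖ ≤ δ) (hy : ‖y‖ ≤ δ) : ‖g x y‖ ≤ K * δ := by
    have h := hg.norm_sub_le (x, y) (0, 0)
    rw [Function.uncurry_apply_pair, Function.uncurry_apply_pair, hg0, sub_zero, Prod.mk_zero_zero,
      sub_zero] at h
    exact h.trans (by gcongr; exact max_le hx hy)
  have h_exp : ‖(rlKernel (1 - α) ⋆ causalExp) t • φ 0‖ ≤ Z * δ := by
    rw [norm_smul]
    exact mul_le_mul (hZ t) (hδ 0 ⟨neg_nonpos.2 hτ, le_rfl⟩) (norm_nonneg _)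
      ((norm_nonneg _).trans (hZ t))
  rw [add_mul, add_mul]
  exact (norm_indicator_le_norm_self _ t).trans <| norm_add₃_le.trans <|
    add_le_add_three h_linear (h_nonlinear _ _ (hx _) (hx _)) h_exp

end Forcing

section IntegratedEquation

variable {ι : Type*} [Fintype ι] {α T t : ℝ} {x y f : ℝ → ι → ℝ}

theorem rlIntegral_apply_eqOn {β : ℝ} (hβ : 0 < β) (hy : CausalContinuous y)
    (hxy : EqOn x y (Icc 0 T)) (i : ι) :
    EqOn (rlIntegral β fun s => x s i) (fun s => (rlKernel β ⋆ y) s i) (Icc 0 T) := by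
  intro t ht
  have h_coord := (causalIntegrable_rlKernel hβ).convolution_clm_comp
    (ContinuousLinearMap.proj (R := ℝ) i) hy
  refine Eq.trans ?_ (congrFun h_coord t)
  exact rlIntegral_eq_rlKernel_convolution (hy.clm_comp _).causal ht.1 fun s hs =>
    congrFun (hxy ⟨hs.1, hs.2.trans ht.2⟩) i

theorem hasCaputoDerivWithin_of_convolution_eq_integral (hα1 : α < 1) (hy : CausalContinuous y)
    (hxy : EqOn (fun s => x s - x 0) y (Icc 0 T)) (hf : Continuous f)
    (h : ∀ s ∈ Icc 0 T, (rlKernel (1 - α) ⋆ y) s = ∫ r in 0..s, f r) (ht : t ∈ Icc 0 T) (i : ι) :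
    HasCaputoDerivWithin α T (fun s => x s i) (f t i) t := by
  have h_eq : EqOn (rlIntegral (1 - α) fun s => x s i - x 0 i) (fun s => (∫ r in 0..s, f r) i)
      (Icc 0 T) := fun s hs =>
    (rlIntegral_apply_eqOn (sub_pos.2 hα1) hy hxy i hs).trans (congrFun (h s hs) i)
  exact ((hasDerivAt_pi.1 (hf.integral_hasStrictDerivAt 0 t).hasDerivAt i).hasDerivWithinAt).congr
    h_eq (h_eq ht)

theorem convolution_eq_integral_of_hasCaputoDerivWithin (hα1 : α < 1) (hy : CausalContinuous y)
    (hxy : EqOn (fun s => x s - x 0) y (Icc 0 T)) (hf : ContinuousOn f (Icc 0 T))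
    (h : ∀ s ∈ Ioo 0 T, ∀ i, HasCaputoDerivWithin α T (fun s => x s i) (f s i) s)
    (ht : t ∈ Icc 0 T) : (rlKernel (1 - α) ⋆ y) t = ∫ s in 0..t, f s := by
  have hk := causalIntegrable_rlKernel (sub_pos.2 hα1)
  have h_deriv : ∀ s ∈ Ioo 0 t, HasDerivAt (rlKernel (1 - α) ⋆ y) (f s) s := by
    refine fun s hs => hasDerivAt_pi.2 fun i => ?_
    have h_mem : Icc 0 T ∈ 𝓝 s := Icc_mem_nhds hs.1 (hs.2.trans_le ht.2)
    refine ((h s ⟨hs.1, hs.2.trans_le ht.2⟩ i).hasDerivAt h_mem).congr_of_eventuallyEq ?_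
    filter_upwards [h_mem] with r hr
    exact (rlIntegral_apply_eqOn (sub_pos.2 hα1) hy hxy i hr).symm
  rw [intervalIntegral.integral_eq_sub_of_hasDerivAt_of_le ht.1
    (hk.continuous_convolution hy).continuousOn h_deriv
    ((hf.mono (Icc_subset_Icc_right ht.2)).intervalIntegrable_of_Icc ht.1),
    hk.causal.convolution_of_nonpos hy.causal le_rfl, sub_zero]

end IntegratedEquation

section Existence

variable {ι : Type*} [Fintype ι] {α τ δ : ℝ} {A : Matrix ι ι ℝ}
  {g : (ι → ℝ) → (ι → ℝ) → ι → ℝ} {φ : ℝ → ι → ℝ}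

/-- The right-hand side of the delay equation along the function `x`. -/
noncomputable def delayRHS (τ : ℝ) (A : Matrix ι ι ℝ) (g : (ι → ℝ) → (ι → ℝ) → ι → ℝ)
    (x : ℝ → ι → ℝ) (t : ℝ) : ι → ℝ :=
  A.mulVec (x (t - τ)) + g (x t) (x (t - τ))

theorem continuous_delayRHS (hg : Continuous (Function.uncurry g)) {x : ℝ → ι → ℝ}
    (hx : Continuous x) : Continuous (delayRHS τ A g x) := by
  have h_shift : Continuous fun t : ℝ => x (t - τ) := hx.comp (by fun_prop)
  exact (continuous_const.matrix_mulVec h_shift).add (hg.comp (hx.prodMk h_shift))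

/-- On `[0, ∞)` this is the increment `x - x 0` of the trajectory `x` through `z`. -/
noncomputable def increment (φ : ℝ → ι → ℝ) (z : ι → DecaySpace) : ℝ → ι → ℝ :=
  realPart z - toSpanSingleton ℝ (φ 0) ∘ (heaviside - causalExp)

theorem causalContinuous_increment (φ : ℝ → ι → ℝ) (z : ι → DecaySpace) :
    CausalContinuous (increment φ z) :=
  (causalContinuous_realPart z).sub
    ((causalContinuous_heaviside.sub causalContinuous_causalExp).clm_comp _)

theorem trajectory_sub_trajectory_zero (hτ : 0 ≤ τ) (φ : ℝ → ι → ℝ) (z : ι → DecaySpace) {t : ℝ}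
    (ht : 0 ≤ t) : trajectory (historyExt τ φ) z t - trajectory (historyExt τ φ) z 0 =
      increment φ z t := by
  simp only [trajectory, increment, Pi.add_apply, Pi.sub_apply, Function.comp_apply, map_sub,
    historyExt_of_nonneg hτ ht, historyExt_of_nonneg hτ le_rfl, realPart_of_nonpos z le_rfl,
    causalExp_of_nonneg ht, indicator_of_mem (mem_Ici.2 ht), Pi.one_apply, toSpanSingleton_apply,
    neg_zero, Real.exp_zero, one_smul, add_zero]
  abel

theorem rlKernel_convolution_increment (hα1 : α < 1) (hτ : 0 ≤ τ)
    (hg : Continuous (Function.uncurry g)) (hφ : ContinuousOn φ (Icc (-τ) 0)) (z : ι → DecaySpace)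
    (hz : rlKernel (1 - α) ⋆ realPart z =
      heaviside ⋆ fun t => A.mulVec (realPart z (t - τ)) + forcing α τ A g φ z t) {t : ℝ}
    (ht : 0 ≤ t) : (rlKernel (1 - α) ⋆ increment φ z) t =
      ∫ s in 0..t, delayRHS τ A g (trajectory (historyExt τ φ) z) s := by
  have hk := causalIntegrable_rlKernel (sub_pos.2 hα1)
  have hH := causalContinuous_heaviside.causalIntegrable
  have he := causalContinuous_causalExp
  have hHe := causalContinuous_heaviside.sub he
  have h_source : CausalContinuous fun t =>
      A.mulVec (realPart z (t - τ)) + forcing α τ A g φ z t :=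
    (causalContinuous_mulVec_realPart hτ A z).add (causalContinuous_forcing hα1 hτ hg hφ z)
  rw [increment, hk.convolution_sub (causalContinuous_realPart z) (hHe.clm_comp _), hz,
    hk.convolution_clm_comp _ hHe, rlKernel_convolution_heaviside_sub_causalExp (sub_pos.2 hα1),
    ← hH.convolution_clm_comp _ (he.convolution hk),
    ← hH.convolution_sub h_source ((he.convolution hk).clm_comp _),
    heaviside_convolution (h_source.sub ((he.convolution hk).clm_comp _)).causal ht]
  refine intervalIntegral.integral_congr fun s hs => ?_
  have hs0 : 0 ≤ s := (uIcc_of_le ht ▸ hs).1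
  simp only [forcing, delayRHS, trajectory, Pi.add_apply, Pi.sub_apply, Function.comp_apply,
    indicator_of_mem (mem_Ici.2 hs0), toSpanSingleton_apply, Matrix.mulVec_add]
  abel

variable {d : ℕ} {A : Matrix (Fin d) (Fin d) ℝ} {g : (Fin d → ℝ) → (Fin d → ℝ) → Fin d → ℝ}
  {φ : ℝ → Fin d → ℝ}

theorem isSolutionOn_trajectory (hα1 : α < 1) (hτ : 0 ≤ τ) (hg : Continuous (Function.uncurry g))
    (hφ : ContinuousOn φ (Icc (-τ) 0)) (z : Fin d → DecaySpace)
    (hz : rlKernel (1 - α) ⋆ realPart z =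
      heaviside ⋆ fun t => A.mulVec (realPart z (t - τ)) + forcing α τ A g φ z t) (T : ℝ) :
    IsSolutionOn α τ A g φ T (trajectory (historyExt τ φ) z) where
  continuousOn := (continuous_trajectory (continuous_historyExt hτ hφ) z).continuousOn
  equation _ ht := hasCaputoDerivWithin_of_convolution_eq_integral hα1
    (causalContinuous_increment φ z)
    (fun _ hs => trajectory_sub_trajectory_zero hτ φ z hs.1)
    (continuous_delayRHS hg (continuous_trajectory (continuous_historyExt hτ hφ) z))
    (fun _ hs => rlKernel_convolution_increment hα1 hτ hg hφ z hz hs.1) ⟨ht.1.le, ht.2⟩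
  initial _ ht := (trajectory_of_nonpos _ z ht.2).trans (historyExt_of_mem ht)

theorem exists_fixedPoint_norm_le {E : Type*} [NormedAddCommGroup E] [CompleteSpace E] {f : E → E}
    (hf : ContractingWith (1 / 2) f) : ∃ z, f z = z ∧ ‖z‖ ≤ 2 * ‖f 0‖ := by
  refine ⟨_, hf.fixedPoint_isFixedPt, ?_⟩
  have h := hf.dist_fixedPoint_le 0
  rw [dist_zero_left, dist_zero_left] at h
  refine h.trans_eq ?_
  norm_num [div_eq_mul_inv, mul_comm]

/-- The Lipschitz constant of the nonlinearity is small enough for the solution operator of the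
linear problem to turn the forcing into a contraction of the space of decaying parts. -/
theorem exists_decayingPart (hα0 : 0 < α) (hα1 : α < 1) (hτ : 0 < τ)
    (hA : spectrum ℂ (A.map (fun a : ℝ => (a : ℂ))) ⊆ stabilityRegion α τ) :
    ∃ K : NNReal, 0 < K ∧ ∃ C : ℝ, 0 ≤ C ∧ ∀ g : (Fin d → ℝ) → (Fin d → ℝ) → Fin d → ℝ,
      g 0 0 = 0 → LipschitzWith K (Function.uncurry g) → ∀ (φ : ℝ → Fin d → ℝ) (δ : ℝ),
      ContinuousOn φ (Icc (-τ) 0) → (∀ s ∈ Icc (-τ) 0, ‖φ s‖ ≤ δ) →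
      ∃ z : Fin d → DecaySpace, ‖z‖ ≤ C * δ ∧ rlKernel (1 - α) ⋆ realPart z =
        heaviside ⋆ fun t => A.mulVec (realPart z (t - τ)) + forcing α τ A g φ z t := by
  obtain ⟨G, hG⟩ := exists_real_linear_solver hα0 hα1 hτ hA
  obtain ⟨Z, hZ⟩ := ((causalContinuous_causalExp).convolution
    (causalIntegrable_rlKernel (sub_pos.2 hα1))).exists_norm_le_of_tendsto
      (tendsto_rlKernel_convolution_causalExp (sub_pos.2 hα1) (sub_lt_self 1 hα0))
  have hQ := integrableKernel_temperedKernel hα0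
  obtain ⟨q, hq⟩ : ∃ q : NNReal, (q : ℝ) = ‖G‖ * ∫ u, ‖temperedKernel α u‖ :=
    ⟨⟨_, by positivity⟩, rfl⟩
  have h_bound {w : ℝ → Fin d → ℝ} {c : ℝ} (hw : CausalContinuous w)
      (hlim : Tendsto w atTop (𝓝 0)) (hc : 0 ≤ c) (hwc : ∀ t, ‖w t‖ ≤ c) :
      ‖G (smoothing hQ hw hlim)‖ ≤ q * c := by
    rw [hq, mul_assoc]
    exact G.le_opNorm_of_le (norm_smoothing_le hQ hw hlim hc hwc)
  obtain ⟨K, hK, hqK⟩ := exists_pos_mul_lt (one_half_pos (α := ℝ)) q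
  lift K to NNReal using hK.le
  set a : ℝ := ‖A.mulVecLin.toContinuousLinearMap‖ + K + Z
  have ha : 0 ≤ a := add_nonneg (by positivity) ((norm_nonneg _).trans (hZ 0))
  refine ⟨K, mod_cast hK, 2 * (q * a), by positivity, fun g hg0 hg φ δ hφ hδ => ?_⟩
  have hδ0 : 0 ≤ δ := (norm_nonneg _).trans (hδ 0 ⟨by linarith, le_rfl⟩)
  have hF := causalContinuous_forcing (A := A) hα1 hτ.le hg.continuous hφ
  have hF_lim := tendsto_forcing (A := A) (φ := φ) hα0 hα1 hτ.le hg.continuous hg0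
  let f : (Fin d → DecaySpace) → Fin d → DecaySpace := fun z => G (smoothing hQ (hF z) (hF_lim z))
  have h_lipschitz : LipschitzWith (q * K) f := LipschitzWith.of_dist_le_mul fun z z' => by
    rw [dist_eq_norm, dist_eq_norm, ← map_sub, smoothing_sub, NNReal.coe_mul, mul_assoc]
    exact h_bound _ _ (by positivity) (norm_forcing_sub_le hg z z')
  have hqK' : q * K ≤ 1 / 2 := NNReal.coe_le_coe.1 (by push_cast; exact hqK.le)
  obtain ⟨z, hz, hz_norm⟩ := exists_fixedPoint_norm_le ⟨by norm_num, h_lipschitz.weaken hqK'⟩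
  have h_zero : ‖f 0‖ ≤ q * (a * δ) :=
    h_bound _ _ (by positivity) (norm_forcing_zero_le hτ.le hg hg0 hZ hδ)
  refine ⟨z, by linarith, ?_⟩
  have h := hG _ (hF z) (hF_lim z)
  rwa [show G _ = z from hz] at h

theorem IsSolutionOn.congr_nonlinearity {g' : (Fin d → ℝ) → (Fin d → ℝ) → Fin d → ℝ}
    {x : ℝ → Fin d → ℝ} {T : ℝ} (hx : IsSolutionOn α τ A g φ T x)
    (h : ∀ t, g (x t) (x (t - τ)) = g' (x t) (x (t - τ))) : IsSolutionOn α τ A g' φ T x where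
  continuousOn := hx.continuousOn
  equation t ht := h t ▸ hx.equation t ht
  initial := hx.initial

theorem exists_decaying_solution (hα0 : 0 < α) (hα1 : α < 1) (hτ : 0 < τ)
    (hA : spectrum ℂ (A.map (fun a : ℝ => (a : ℂ))) ⊆ stabilityRegion α τ) :
    ∃ K : NNReal, 0 < K ∧ ∃ C : ℝ, 0 < C ∧
      ∀ (g : (Fin d → ℝ) → (Fin d → ℝ) → Fin d → ℝ) (ρ : ℝ), g 0 0 = 0 →
      LipschitzOnWith K (Function.uncurry g) (Metric.closedBall 0 ρ) →
      ∀ (φ : ℝ → Fin d → ℝ) (δ : ℝ), ContinuousOn φ (Icc (-τ) 0) →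
      (∀ s ∈ Icc (-τ) 0, ‖φ s‖ ≤ δ) → C * δ ≤ ρ →
      ∃ x : ℝ → Fin d → ℝ, (∀ T, IsSolutionOn α τ A g φ T x) ∧ (∀ t, ‖x t‖ ≤ C * δ) ∧
        Tendsto x atTop (𝓝 0) := by
  obtain ⟨K, hK, C, hC, h⟩ := exists_decayingPart hα0 hα1 hτ hA
  refine ⟨K, hK, 1 + C, by positivity, fun g ρ hg0 hg φ δ hφ hδ hδρ => ?_⟩
  obtain ⟨f, hf, hgf⟩ := hg.extend_pi
  have hδ0 : 0 ≤ δ := (norm_nonneg _).trans (hδ 0 ⟨by linarith, le_rfl⟩)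
  have hf0 : f 0 = 0 := (hgf (Metric.mem_closedBall_self (by nlinarith))).symm.trans hg0
  obtain ⟨z, hz_norm, hz⟩ := h (Function.curry f) hf0 hf φ δ hφ hδ
  have hx_norm (t : ℝ) : ‖trajectory (historyExt τ φ) z t‖ ≤ (1 + C) * δ :=
    (norm_trajectory_le _ z t).trans (by linarith [norm_historyExt_le hτ.le hδ t])
  refine ⟨trajectory (historyExt τ φ) z, fun T => ?_, hx_norm,
    tendsto_trajectory (tendsto_historyExt hτ.le) z⟩
  refine (isSolutionOn_trajectory (g := Function.curry f) hα1 hτ.le hf.continuous hφ z hz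
    T).congr_nonlinearity fun t => (hgf ?_).symm
  exact mem_closedBall_zero_iff.2 ((max_le (hx_norm _) (hx_norm _)).trans hδρ)

end Existence

/-! ### Uniqueness -/

section VolterraEquation

variable {E : Type*} [NormedAddCommGroup E] {α T : ℝ} {v w F : ℝ → E}

theorem exists_causalContinuous_eqOn (hT : 0 ≤ T) {f : ℝ → E} (hf : ContinuousOn f (Icc 0 T)) :
    ∃ F : ℝ → E, CausalContinuous F ∧ EqOn F f (Icc 0 T) := by
  refine ⟨_, .indicator_Ici (hf.domRestrict.Icc_extend' (h := hT)), fun t ht => ?_⟩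
  rw [indicator_of_mem (mem_Ici.2 ht.1), IccExtend_of_mem _ _ ht, domRestrict_apply]

variable [NormedSpace ℝ E]

theorem eqOn_of_heaviside_convolution_eqOn [CompleteSpace E] (hT : 0 < T)
    (hv : CausalContinuous v) (hw : CausalContinuous w)
    (h : EqOn (heaviside ⋆ v) (heaviside ⋆ w) (Icc 0 T)) : EqOn v w (Icc 0 T) := by
  have h_deriv {w : ℝ → E} (hw : CausalContinuous w) {t : ℝ} (ht : 0 < t) :
      HasDerivAt (heaviside ⋆ w) (w t) t := by
    refine HasDerivAt.congr_of_eventuallyEq (f := fun s => ∫ r in 0..s, w r) ?_ ?_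
    · exact intervalIntegral.integral_hasDerivAt_right
        (hw.causalIntegrable.integrableOn_Iic t |>.mono_set (uIoc_of_le ht.le ▸ Ioc_subset_Iic_self)
          |> intervalIntegrable_iff.2)
        (hw.causalIntegrable.aestronglyMeasurable.stronglyMeasurableAtFilter)
        (hw.continuousAt ht.ne')
    · filter_upwards [Ioi_mem_nhds ht] with s hs using heaviside_convolution hw.causal (le_of_lt hs)
  have h_Ioo : EqOn v w (Ioo 0 T) := fun t ht => by
    refine (h_deriv hv ht.1).unique ((h_deriv hw ht.1).congr_of_eventuallyEq ?_)
    filter_upwards [Icc_mem_nhds ht.1 ht.2] with s hs using h hs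
  exact h_Ioo.of_subset_closure (hv.continuousOn_Ici.mono Icc_subset_Ici_self)
    (hw.continuousOn_Ici.mono Icc_subset_Ici_self) Ioo_subset_Icc_self
    (closure_Ioo hT.ne).ge

/-- The fractional integral of order `α` composed with the one of order `1 - α` is integration. -/
theorem eqOn_rlKernel_convolution [CompleteSpace E] (hα0 : 0 < α) (hα1 : α < 1) (hT : 0 < T)
    (hv : CausalContinuous v) (hF : CausalContinuous F)
    (h : EqOn (rlKernel (1 - α) ⋆ v) (heaviside ⋆ F) (Icc 0 T)) :
    EqOn v (rlKernel α ⋆ F) (Icc 0 T) := by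
  have hk := causalIntegrable_rlKernel hα0
  have hk' := causalIntegrable_rlKernel (sub_pos.2 hα1)
  have hH := causalContinuous_heaviside.causalIntegrable
  have hv' := hv.convolution hk'
  have hF' := hF.convolution hH
  refine eqOn_of_heaviside_convolution_eqOn hT hv (hF.convolution hk) fun t ht => ?_
  calc (heaviside ⋆ v) t = ((rlKernel α ⋆ rlKernel (1 - α)) ⋆ v) t := by
        rw [rlKernel_convolution_rlKernel hα0 (sub_pos.2 hα1), add_sub_cancel,
          convolution_congr _ heaviside_ae_eq_rlKernel_one .rfl]
    _ = (rlKernel α ⋆ (rlKernel (1 - α) ⋆ v)) t := by rw [hk.convolution_assoc hk' hv]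
    _ = (rlKernel α ⋆ (heaviside ⋆ F)) t :=
        hk.causal.convolution_congr hk.causal hv'.causal hF'.causal (fun _ _ => rfl) fun s hs =>
          (lt_or_ge s 0).elim (fun hs0 => (hv'.causal s hs0).trans (hF'.causal s hs0).symm)
            fun hs0 => h ⟨hs0, hs.trans ht.2⟩
    _ = (heaviside ⋆ (rlKernel α ⋆ F)) t := by rw [hk.convolution_left_comm hH hF]

theorem norm_rlKernel_convolution_le {β c C t : ℝ} (hβ : 0 < β) (hc : 0 < c) (hC : 0 ≤ C)
    (hF : Causal F) (h : ∀ s ∈ Icc 0 t, ‖F s‖ ≤ C * Real.exp (c * s)) :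
    ‖(rlKernel β ⋆ F) t‖ ≤ c ^ (-β) * (C * Real.exp (c * t)) := by
  rw [← integral_rlKernel_mul_exp hβ hc, ← integral_mul_const]
  refine norm_integral_le_of_norm_le ((integrable_rlKernel_mul_exp hβ hc).mul_const _)
    (.of_forall fun u => ?_)
  rw [lsmul_apply, norm_smul, Real.norm_of_nonneg (rlKernel_nonneg hβ u), mul_assoc]
  rcases le_or_gt u 0 with hu | hu
  · simp [rlKernel_of_nonpos hu]
  refine mul_le_mul_of_nonneg_left ?_ (rlKernel_nonneg hβ u)
  rcases lt_or_ge (t - u) 0 with htu | htu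
  · rw [hF _ htu, norm_zero]
    positivity
  · refine (h _ ⟨htu, by linarith⟩).trans_eq ?_
    rw [mul_left_comm, ← Real.exp_add]
    ring_nf

/-- Bielecki's argument: in the norm `sup exp (-(c * t)) * ‖v t‖` the fractional integral has norm
at most `c ^ (-α)`, which is small for large `c`. -/
theorem eqOn_zero_of_eqOn_rlKernel_convolution {M : ℝ} (hα : 0 < α) (hv : ContinuousOn v (Icc 0 T))
    (hF : Causal F) (hvF : EqOn v (rlKernel α ⋆ F) (Icc 0 T))
    (h : ∀ t ∈ Icc 0 T, ∀ C, (∀ s ∈ Icc 0 t, ‖v s‖ ≤ C) → ‖F t‖ ≤ M * C) :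
    EqOn v 0 (Icc 0 T) := by
  rcases (Icc 0 T).eq_empty_or_nonempty with h_empty | h_nonempty
  · simp [h_empty]
  obtain ⟨c, hc, hcM⟩ : ∃ c : ℝ, 0 < c ∧ |M| * c ^ (-α) < 1 := by
    have h_lim := (tendsto_rpow_neg_atTop hα).const_mul |M|
    rw [mul_zero] at h_lim
    exact ((eventually_gt_atTop 0).and (h_lim.eventually_lt_const one_pos)).exists
  obtain ⟨r, hr, hr_max⟩ := isCompact_Icc.exists_isMaxOn h_nonempty
    (f := fun t => Real.exp (-(c * t)) * ‖v t‖) (by fun_prop)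
  set m := Real.exp (-(c * r)) * ‖v r‖ with hm
  have hm0 : 0 ≤ m := by positivity
  have hv_le {t : ℝ} (ht : t ∈ Icc 0 T) : ‖v t‖ ≤ m * Real.exp (c * t) := by
    have : Real.exp (-(c * t)) * ‖v t‖ ≤ m := hr_max ht
    rwa [Real.exp_neg, inv_mul_le_iff₀ (Real.exp_pos _), mul_comm] at this
  have hF_le : ∀ s ∈ Icc 0 r, ‖F s‖ ≤ |M| * m * Real.exp (c * s) := fun s hs => by
    have hsT : s ≤ T := hs.2.trans hr.2
    have := h s ⟨hs.1, hsT⟩ (m * Real.exp (c * s)) fun u hu =>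
      (hv_le ⟨hu.1, hu.2.trans hsT⟩).trans (by gcongr; exact hu.2)
    refine this.trans ?_
    rw [mul_assoc |M|]
    exact mul_le_mul_of_nonneg_right (le_abs_self M) (by positivity)
  have hm_zero : m = 0 := by
    have h_le : ‖v r‖ ≤ c ^ (-α) * (|M| * m * Real.exp (c * r)) :=
      hvF hr ▸ norm_rlKernel_convolution_le hα hc (by positivity) hF hF_le
    have h_contr : m ≤ |M| * c ^ (-α) * m := by
      rw [hm, Real.exp_neg, inv_mul_le_iff₀ (Real.exp_pos _), ← Real.exp_neg, ← hm]
      exact h_le.trans_eq (by ring)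
    nlinarith
  exact fun t ht => norm_le_zero_iff.1 ((hv_le ht).trans_eq (by rw [hm_zero, zero_mul]))

end VolterraEquation

section Uniqueness

variable {d : ℕ} {α τ T : ℝ} {A : Matrix (Fin d) (Fin d) ℝ}
  {g : (Fin d → ℝ) → (Fin d → ℝ) → Fin d → ℝ} {φ x y : ℝ → Fin d → ℝ}

theorem IsSolutionOn.mono {S : ℝ} (hx : IsSolutionOn α τ A g φ T x) (hST : S ≤ T) :
    IsSolutionOn α τ A g φ S x where
  continuousOn := hx.continuousOn.mono (Icc_subset_Icc_right hST)
  equation t ht i := (hx.equation t ⟨ht.1, ht.2.trans hST⟩ i).mono (Icc_subset_Icc_right hST)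
  initial := hx.initial

theorem IsSolutionOn.continuousOn_delayRHS {s : Set ((Fin d → ℝ) × (Fin d → ℝ))} (hτ : 0 ≤ τ)
    (hg : ContinuousOn (Function.uncurry g) s) (hx : IsSolutionOn α τ A g φ T x)
    (hxs : ∀ t ∈ Icc 0 T, (x t, x (t - τ)) ∈ s) : ContinuousOn (delayRHS τ A g x) (Icc 0 T) := by
  have h_shift : ContinuousOn (fun t => x (t - τ)) (Icc 0 T) :=
    hx.continuousOn.comp (by fun_prop) fun t ht => ⟨by linarith [ht.1], by linarith [ht.2]⟩
  have h_linear := A.mulVecLin.continuous_of_finiteDimensional.comp_continuousOn h_shift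
  exact h_linear.add <| hg.comp
    ((hx.continuousOn.mono (Icc_subset_Icc_left (neg_nonpos.2 hτ))).prodMk h_shift) hxs

theorem IsSolutionOn.sub_eqOn_rlKernel_convolution (hα0 : 0 < α) (hα1 : α < 1) (hτ : 0 ≤ τ)
    (hT : 0 < T) (hx : IsSolutionOn α τ A g φ T x) {F : ℝ → Fin d → ℝ} (hF : CausalContinuous F)
    (hxF : EqOn F (delayRHS τ A g x) (Icc 0 T)) :
    EqOn (fun t => x t - x 0) (rlKernel α ⋆ F) (Icc 0 T) := by
  have h_subset : Icc 0 T ⊆ Icc (-τ) T := Icc_subset_Icc_left (neg_nonpos.2 hτ)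
  obtain ⟨X, hX, hxX⟩ := exists_causalContinuous_eqOn (f := fun t => x t - x 0) hT.le
    ((hx.continuousOn.mono h_subset).sub continuousOn_const)
  refine hxX.symm.trans (eqOn_rlKernel_convolution hα0 hα1 hT hX hF fun t ht => ?_)
  rw [heaviside_convolution hF.causal ht.1]
  refine convolution_eq_integral_of_hasCaputoDerivWithin hα1 hX hxX.symm
    (hF.continuousOn_Ici.mono Icc_subset_Ici_self) (fun s hs i => ?_) ht
  rw [hxF ⟨hs.1.le, hs.2.le⟩]
  exact hx.equation s ⟨hs.1, hs.2.le⟩ i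

variable {K : NNReal}

theorem norm_delayRHS_sub_le {s : Set ((Fin d → ℝ) × (Fin d → ℝ))}
    (hg : LipschitzOnWith K (Function.uncurry g) s) {t C : ℝ} (hxs : (x t, x (t - τ)) ∈ s)
    (hys : (y t, y (t - τ)) ∈ s) (h : ‖x t - y t‖ ≤ C) (h_delay : ‖x (t - τ) - y (t - τ)‖ ≤ C) :
    ‖delayRHS τ A g x t - delayRHS τ A g y t‖ ≤
      (‖A.mulVecLin.toContinuousLinearMap‖ + K) * C := by
  have h_linear : ‖A.mulVec (x (t - τ) - y (t - τ))‖ ≤ ‖A.mulVecLin.toContinuousLinearMap‖ * C :=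
    A.mulVecLin.toContinuousLinearMap.le_opNorm_of_le h_delay
  have h_nonlinear : ‖g (x t) (x (t - τ)) - g (y t) (y (t - τ))‖ ≤ K * C :=
    (hg.norm_sub_le hxs hys).trans (by gcongr; exact max_le h h_delay)
  rw [delayRHS, delayRHS, add_sub_add_comm, ← A.mulVec_sub, add_mul]
  exact norm_add_le_of_le h_linear h_nonlinear

theorem IsSolutionOn.eqOn_of_mem {s : Set ((Fin d → ℝ) × (Fin d → ℝ))} (hα0 : 0 < α) (hα1 : α < 1)
    (hτ : 0 ≤ τ) (hg : LipschitzOnWith K (Function.uncurry g) s) (hx : IsSolutionOn α τ A g φ T x)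
    (hy : IsSolutionOn α τ A g φ T y) (hxs : ∀ t ∈ Icc 0 T, (x t, x (t - τ)) ∈ s)
    (hys : ∀ t ∈ Icc 0 T, (y t, y (t - τ)) ∈ s) : EqOn y x (Icc (-τ) T) := by
  have h_init {t : ℝ} (ht : t ∈ Icc (-τ) 0) : x t = y t :=
    (hx.initial t ht).trans (hy.initial t ht).symm
  rcases le_or_gt T 0 with hT | hT
  · exact fun t ht => (h_init ⟨ht.1, ht.2.trans hT⟩).symm
  obtain ⟨P, hP, hxP⟩ := exists_causalContinuous_eqOn hT.le
    (hx.continuousOn_delayRHS hτ hg.continuousOn hxs)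
  obtain ⟨Q, hQ, hyQ⟩ := exists_causalContinuous_eqOn hT.le
    (hy.continuousOn_delayRHS hτ hg.continuousOn hys)
  have h_volterra : EqOn (x - y) (rlKernel α ⋆ (P - Q)) (Icc 0 T) := fun t ht => by
    have hxt := hx.sub_eqOn_rlKernel_convolution hα0 hα1 hτ hT hP hxP ht
    have hyt := hy.sub_eqOn_rlKernel_convolution hα0 hα1 hτ hT hQ hyQ ht
    rw [(causalIntegrable_rlKernel hα0).convolution_sub hP hQ, Pi.sub_apply, Pi.sub_apply, ← hxt,
      ← hyt, h_init ⟨neg_nonpos.2 hτ, le_rfl⟩, sub_sub_sub_cancel_right]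
  have h_subset : Icc 0 T ⊆ Icc (-τ) T := Icc_subset_Icc_left (neg_nonpos.2 hτ)
  have h_zero := eqOn_zero_of_eqOn_rlKernel_convolution hα0
    ((hx.continuousOn.mono h_subset).sub (hy.continuousOn.mono h_subset)) (hP.sub hQ).causal
    h_volterra fun t ht C hC => by
      rw [Pi.sub_apply, hxP ht, hyQ ht]
      refine norm_delayRHS_sub_le hg (hxs t ht) (hys t ht) (hC t ⟨ht.1, le_rfl⟩) ?_
      rcases le_total (t - τ) 0 with h | h
      · rw [h_init ⟨by linarith [ht.1], h⟩, sub_self, norm_zero]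
        exact (norm_nonneg _).trans (hC t ⟨ht.1, le_rfl⟩)
      · exact hC _ ⟨h, by linarith⟩
  intro t ht
  rcases le_total t 0 with h | h
  · exact (h_init ⟨ht.1, h⟩).symm
  · exact (sub_eq_zero.1 (h_zero ⟨h, ht.2⟩)).symm

/-- A solution cannot leave the ball `closedBall 0 ρ`: up to a first time with `ρ ≤ ‖y t‖` it
would agree with `x`. -/
theorem IsSolutionOn.eqOn (hα0 : 0 < α) (hα1 : α < 1) (hτ : 0 ≤ τ) {ρ : ℝ}
    (hg : LipschitzOnWith K (Function.uncurry g) (Metric.closedBall 0 ρ))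
    (hx : IsSolutionOn α τ A g φ T x) (hy : IsSolutionOn α τ A g φ T y)
    (hxρ : ∀ t ∈ Icc (-τ) T, ‖x t‖ < ρ) : EqOn y x (Icc (-τ) T) := by
  have h_local {S : ℝ} (hST : S ≤ T) (hyρ : ∀ t ∈ Icc (-τ) S, ‖y t‖ ≤ ρ) :
      EqOn y x (Icc (-τ) S) := by
    have h_mem {z : ℝ → Fin d → ℝ} (hz : ∀ t ∈ Icc (-τ) S, ‖z t‖ ≤ ρ) :
        ∀ t ∈ Icc 0 S, (z t, z (t - τ)) ∈ Metric.closedBall 0 ρ := fun t ht =>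
      mem_closedBall_zero_iff.2 <| max_le (hz t ⟨by linarith [ht.1], ht.2⟩)
        (hz _ ⟨by linarith [ht.1], by linarith [ht.2]⟩)
    exact (hx.mono hST).eqOn_of_mem hα0 hα1 hτ hg (hy.mono hST)
      (h_mem fun t ht => (hxρ t ⟨ht.1, ht.2.trans hST⟩).le) (h_mem hyρ)
  refine h_local le_rfl ?_
  by_contra! h_exit
  obtain ⟨S, ⟨hS, hSρ⟩, hS_least⟩ : ∃ S, IsLeast {t ∈ Icc (-τ) T | ρ ≤ ‖y t‖} S :=
    (isCompact_Icc.of_isClosed_subset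
      (hy.continuousOn.norm.preimage_isClosed_of_isClosed isClosed_Icc isClosed_Ici)
      inter_subset_left).exists_isLeast (h_exit.imp fun t ht => ⟨ht.1, ht.2.le⟩)
  have hS_ne : y S ≠ x S := fun h => (hxρ S hS).not_ge (h ▸ hSρ)
  have hS_pos : 0 < S := lt_of_not_ge fun h =>
    hS_ne ((hy.initial S ⟨hS.1, h⟩).trans (hx.initial S ⟨hS.1, h⟩).symm)
  have h_closed : IsClosed {t ∈ Icc (-τ) S | ‖y t‖ ≤ ρ} :=
    (hy.mono hS.2).continuousOn.norm.preimage_isClosed_of_isClosed isClosed_Icc isClosed_Iic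
  have h_before : Ico (-τ) S ⊆ {t ∈ Icc (-τ) S | ‖y t‖ ≤ ρ} := fun t ht =>
    ⟨⟨ht.1, ht.2.le⟩, le_of_not_ge fun h => (hS_least ⟨⟨ht.1, ht.2.le.trans hS.2⟩, h⟩).not_gt ht.2⟩
  have hyρ := closure_minimal h_before h_closed
  rw [closure_Ico (by linarith)] at hyρ
  exact hS_ne (h_local hS.2 (fun t ht => (hyρ ht).2) ⟨hS.1, le_rfl⟩)

end Uniqueness

section Norms

variable {E : Type*} [NormedAddCommGroup E] [NormedSpace ℝ E] [FiniteDimensional ℝ E]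

theorem continuous_seminorm (p : Seminorm ℝ E) : Continuous p :=
  p.convexOn.locallyLipschitz.continuous

theorem exists_norm_le_mul_seminorm {p : Seminorm ℝ E} (hp : ∀ v, p v = 0 → v = 0) :
    ∃ C : ℝ, 0 < C ∧ ∀ v, ‖v‖ ≤ C * p v := by
  have h_pos : ∀ v ∈ Metric.sphere (0 : E) 1, 0 < p v := fun v hv =>
    (apply_nonneg p v).lt_of_ne' fun h => ne_zero_of_mem_unit_sphere ⟨v, hv⟩ (hp v h)
  obtain ⟨m, hm, hmp⟩ := (isCompact_sphere (0 : E) 1).exists_forall_le'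
    (continuous_seminorm p).continuousOn h_pos
  refine ⟨m⁻¹, inv_pos.2 hm, fun v => ?_⟩
  rcases eq_or_ne v 0 with rfl | hv
  · simp
  · have h := hmp (‖v‖⁻¹ • v) (by simp [norm_smul, hv])
    rwa [map_smul_eq_mul, norm_inv, norm_norm, le_inv_mul_iff₀ (norm_pos_iff.2 hv), mul_comm,
      ← le_inv_mul_iff₀ hm] at h

end Norms

variable {d : ℕ} {p : Seminorm ℝ (Fin d → ℝ)} {g : (Fin d → ℝ) → (Fin d → ℝ) → Fin d → ℝ}

theorem seminorm_sub_le_of_lipModulus_lt (hp : ∀ v, p v = 0 → v = 0) {κ ρ : ℝ}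
    (h : lipModulus p g ρ < ENNReal.ofReal κ) {x y x' y' : Fin d → ℝ} (hx : p x ≤ ρ)
    (hy : p y ≤ ρ) (hx' : p x' ≤ ρ) (hy' : p y' ≤ ρ) :
    p (g x y - g x' y') ≤ κ * (p (x - x') + p (y - y')) := by
  rcases eq_or_ne (x, y) (x', y') with h_eq | h_ne
  · obtain ⟨rfl, rfl⟩ := Prod.mk.inj h_eq
    simp
  have h_le : ENNReal.ofReal (p (g x y - g x' y') / (p (x - x') + p (y - y'))) ≤
      lipModulus p g ρ :=
    le_iSup_of_le x <| le_iSup_of_le y <| le_iSup_of_le x' <| le_iSup_of_le y' <|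
      le_iSup_of_le ⟨⟨hx, hy, hx', hy'⟩, h_ne⟩ le_rfl
  have h_pos : 0 < p (x - x') + p (y - y') := by
    have hx0 := apply_nonneg p (x - x')
    have hy0 := apply_nonneg p (y - y')
    refine (add_nonneg hx0 hy0).lt_of_ne' fun h0 => h_ne ?_
    rw [sub_eq_zero.1 (hp (x - x') (by linarith)), sub_eq_zero.1 (hp (y - y') (by linarith))]
  rw [← div_le_iff₀ h_pos]
  exact (ENNReal.ofReal_lt_ofReal_iff'.1 (h_le.trans_lt h)).1.le

theorem exists_lipschitzOnWith_closedBall (hp : ∀ v, p v = 0 → v = 0)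
    (hg : Tendsto (lipModulus p g) (𝓝[>] 0) (𝓝 0)) {K : NNReal} (hK : 0 < K) :
    ∃ ρ : ℝ, 0 < ρ ∧ LipschitzOnWith K (Function.uncurry g) (Metric.closedBall 0 ρ) := by
  obtain ⟨c, hc, hpc⟩ := Seminorm.bound_of_continuous_normedSpace p (continuous_seminorm p)
  obtain ⟨C, hC, hCp⟩ := exists_norm_le_mul_seminorm hp
  have hκ : 0 < K / (2 * C * c) := by positivity
  obtain ⟨r, hr, hr0⟩ := ((hg.eventually_lt_const (ENNReal.ofReal_pos.2 hκ)).and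
    self_mem_nhdsWithin).exists
  have h_ball {v : Fin d → ℝ} (hv : ‖v‖ ≤ r / c) : p v ≤ r :=
    (hpc v).trans ((le_div_iff₀' hc).1 hv)
  refine ⟨r / c, div_pos hr0 hc, LipschitzOnWith.of_dist_le_mul ?_⟩
  rintro ⟨x, y⟩ hxy ⟨x', y'⟩ hxy'
  obtain ⟨hx, hy⟩ := max_le_iff.1 (mem_closedBall_zero_iff.1 hxy)
  obtain ⟨hx', hy'⟩ := max_le_iff.1 (mem_closedBall_zero_iff.1 hxy')
  rw [dist_eq_norm, dist_eq_norm]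
  have hx_sub : p (x - x') ≤ c * ‖(x, y) - (x', y')‖ :=
    (hpc _).trans (by gcongr; exact le_max_left _ _)
  have hy_sub : p (y - y') ≤ c * ‖(x, y) - (x', y')‖ :=
    (hpc _).trans (by gcongr; exact le_max_right _ _)
  calc ‖g x y - g x' y'‖ ≤ C * p (g x y - g x' y') := hCp _
    _ ≤ C * (K / (2 * C * c) * (p (x - x') + p (y - y'))) := by
      gcongr
      exact seminorm_sub_le_of_lipModulus_lt hp hr (h_ball hx) (h_ball hy) (h_ball hx') (h_ball hy')
    _ ≤ C * (K / (2 * C * c) * (c * ‖(x, y) - (x', y')‖ + c * ‖(x, y) - (x', y')‖)) := by gcongr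
    _ = K * ‖(x, y) - (x', y')‖ := by
      field_simp
      ring

theorem exists_isTheGlobalSolution {α τ : ℝ} {A : Matrix (Fin d) (Fin d) ℝ}
    (hp : ∀ v, p v = 0 → v = 0) (hα0 : 0 < α) (hα1 : α < 1) (hτ : 0 < τ)
    (hA : spectrum ℂ (A.map (fun a : ℝ => (a : ℂ))) ⊆ stabilityRegion α τ) (hg0 : g 0 0 = 0)
    (hg : Tendsto (lipModulus p g) (𝓝[>] 0) (𝓝 0)) {ε : ℝ} (hε : 0 < ε) :
    ∃ δ : ℝ, 0 < δ ∧ ∀ φ : ℝ → Fin d → ℝ, ContinuousOn φ (Icc (-τ) 0) →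
      (∀ s ∈ Icc (-τ) 0, p (φ s) ≤ δ) → ∃ x : ℝ → Fin d → ℝ,
        IsTheGlobalSolution α τ A g φ x ∧ (∀ t, p (x t) ≤ ε) ∧ Tendsto x atTop (𝓝 0) := by
  obtain ⟨K, hK, B, hB, h_exists⟩ := exists_decaying_solution hα0 hα1 hτ hA
  obtain ⟨ρ, hρ, h_lipschitz⟩ := exists_lipschitzOnWith_closedBall hp hg hK
  obtain ⟨c, hc, hpc⟩ := Seminorm.bound_of_continuous_normedSpace p (continuous_seminorm p)
  obtain ⟨C, hC, hCp⟩ := exists_norm_le_mul_seminorm hp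
  obtain ⟨r, hr, hr_lt⟩ := exists_between (lt_min hρ (div_pos hε hc))
  obtain ⟨hrρ, hrε⟩ := lt_min_iff.1 hr_lt
  refine ⟨r / (B * C), by positivity, fun φ hφ hφδ => ?_⟩
  have hBr : B * (r / B) = r := mul_div_cancel₀ r hB.ne'
  have hφr (s : ℝ) (hs : s ∈ Icc (-τ) 0) : ‖φ s‖ ≤ r / B :=
    calc ‖φ s‖ ≤ C * p (φ s) := hCp _
      _ ≤ C * (r / (B * C)) := by gcongr; exact hφδ s hs
      _ = r / B := by field_simp
  obtain ⟨x, hx, hx_norm, hx_lim⟩ :=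
    h_exists g ρ hg0 h_lipschitz φ (r / B) hφ hφr (hBr.trans_le hrρ.le)
  rw [hBr] at hx_norm
  refine ⟨x, ⟨fun T _ => hx T, fun T _ y hy => ?_⟩, fun t => ?_, hx_lim⟩
  · exact (hx T).eqOn hα0 hα1 hτ.le h_lipschitz hy fun t _ => (hx_norm t).trans_lt hrρ
  · exact (hpc _).trans ((le_div_iff₀' hc).1 ((hx_norm t).trans hrε.le))

end DelayFDE

theorem mainTheorem1 {d : ℕ} (p : Seminorm ℝ (Fin d → ℝ)) (hp : ∀ v : Fin d → ℝ, p v = 0 → v = 0)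
    (α τ : ℝ) (hα0 : 0 < α) (hα1 : α < 1) (hτ : 0 < τ)
    (A : Matrix (Fin d) (Fin d) ℝ)
    (hA : spectrum ℂ (A.map (fun a : ℝ => (a : ℂ))) ⊆ DelayFDE.stabilityRegion α τ)
    (g : (Fin d → ℝ) → (Fin d → ℝ) → (Fin d → ℝ))
    (hg0 : g 0 0 = 0)
    (hgLip : ∃ U ∈ 𝓝 (0 : (Fin d → ℝ) × (Fin d → ℝ)),
      LocallyLipschitzOn U (fun z : (Fin d → ℝ) × (Fin d → ℝ) => g z.1 z.2))
    (hgMod : Tendsto (DelayFDE.lipModulus p g) (𝓝[>] 0) (𝓝 0)) :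
    DelayFDE.IsAsymptoticallyStable p α τ A g := by
  refine ⟨fun ε hε => ?_, ?_⟩
  · obtain ⟨δ, hδ, h_exists⟩ :=
      DelayFDE.exists_isTheGlobalSolution hp hα0 hα1 hτ hA hg0 hgMod hε
    refine ⟨δ, hδ, fun φ hφ hφδ => ?_⟩
    obtain ⟨x, hx, hx_le, -⟩ := h_exists φ hφ hφδ
    exact ⟨x, hx, fun t _ => hx_le t⟩
  · obtain ⟨δ, hδ, h_exists⟩ :=
      DelayFDE.exists_isTheGlobalSolution hp hα0 hα1 hτ hA hg0 hgMod one_pos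
    refine ⟨δ, hδ, fun φ hφ hφδ => ?_⟩
    obtain ⟨x, hx, -, hx_lim⟩ := h_exists φ hφ hφδ
    exact ⟨x, hx, hx_lim⟩
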